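/- Let $M$ be a smooth ($C^\infty$) $n$-dimensional manifold, let $LM$ be its bundle of linear frames $l:\mathbb R^n\to T_xM$, and let $\mathcal F^2M$ be its bundle of $2$-frames, i.e. of $2$-jets at $0$ of inverses of charts of $M$. Let $S^2_n$ be the space of symmetric bilinear maps $\mathbb R^n\times\mathbb R^n\to\mathbb R^n$. The structure group of $\mathcal F^2M$ is $G^2_n=\mathrm{GL}(n,\mathbb R)\rtimes S^2_n$, with product $(a,s)(b,t)=(ab,\,b^{-1}s(b\cdot,b\cdot)+t)$; the pair $(a,s)$ is the $2$-jet at $0$ of $\xi\mapsto a(\xi+\tfrac12 s(\xi,\xi))$ and acts on the right on $2$-frames by composition of jets. Let $G$ be a subgroup of $\mathrm{GL}(n,\mathbb R)$ with Lie algebra $\mathfrak g$ (the velocities at the identity of smooth curves in $G$), and let $\mathfrak g_1=\{s\in S^2_n : s(v,\cdot)\in\mathfrak g\ \text{for all } v\in\mathbb R^n\}$ be its first prolongation; $G\rtimes\mathfrak g_1$ is a subgroup of $G^2_n$. A first order $G$-structure on $M$ is a reduction $P$ of $LM$ to $G$; for a subgroup $K\subseteq G^2_n$, a second order $K$-structure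 is a reduction of $\mathcal F^2M$ to $K$. Here a reduction of a principal bundle to a subgroup is a subset that is invariant under the subgroup, meets each fibre in a single orbit of it, and has smooth local sections near every point of $M$. The tangent space $T_lP\subseteq T_lLM$ consists of the velocities at $l$ of smooth curves in $P$. A subspace $H\subseteq T_lLM$ is a transversal $n$-subspace if it is a complement of the vertical subspace, and it is torsion-free if $d\theta$ vanishes on $H\times H$, where $\theta_l(X)=l^{-1}(d\pi X)$ is the canonical form of $LM$ and $\pi:LM\to M$ is the projection. A symmetric connection on $P$ is a smooth $G$-invariant distribution $l\mapsto H_l\subseteq T_lP$ $(l\in P)$ of torsion-free transversal $n$-subspaces. The $2$-frame given by a chart $e$ with $0$ in its image corresponds to the torsion-free transversal $n$-subspace of $T_lLM$, $l=d(e^{-1})_0$, that is the image of the differential at $0$ of $\xi\mapsto d(e^{-1})_\xi\in LM$. Theorem. If a first order $G$-structure $P$ on $M$ admits a symmetric connection, then the set $P^2\subseteq\mathcal F^2M$ of the $2$-frames whose corresponding torsion-free transversal $n$-subspace is contained in $T_lP$ for some $l\in P$ is a second order $G\rtimes\mathfrak g_1$-structure on $M$. -/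

import Mathlib

open scoped Manifold ContDiff Topology
open Bundle

set_option linter.unusedSectionVars false

noncomputable section

namespace GStr

/-! ### The model space and the groups of 1-jets and 2-jets -/

/-- The model space `ℝⁿ`. -/
abbrev E (n : ℕ) := EuclideanSpace ℝ (Fin n)

/-- The group `G¹ₙ = GL(n, ℝ)`; the product is composition. -/
abbrev GLn (n : ℕ) := E n ≃L[ℝ] E n

/-- The space `S²ₙ` of symmetric bilinear maps `ℝⁿ × ℝⁿ → ℝⁿ`. -/
def S2 (n : ℕ) : Submodule ℝ (E n →L[ℝ] E n →L[ℝ] E n) where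
  carrier := {s | ∀ u v, s u v = s v u}
  add_mem' := fun {s t} hs ht u v => by simp [hs u v, ht u v]
  zero_mem' := fun u v => by simp
  smul_mem' := fun c s hs u v => by simp [hs u v]

instance (n : ℕ) : AddCommGroup (E n →L[ℝ] E n →L[ℝ] E n) := ContinuousLinearMap.addCommGroup

instance (n : ℕ) : AddCommGroup (S2 n) := Submodule.addCommGroup (S2 n)

/-- The right action of `GL(n, ℝ)` on `S²ₙ`: `(u, v) ↦ b⁻¹ s(b u, b v)`. -/
def S2.pull {n : ℕ} (b : GLn n) (s : S2 n) : S2 n :=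
  ⟨((ContinuousLinearMap.compL ℝ (E n) (E n) (E n) (b.symm : E n →L[ℝ] E n)).comp
      ((ContinuousLinearMap.compL ℝ (E n) (E n) (E n)).flip (b : E n →L[ℝ] E n))).comp
        ((s : E n →L[ℝ] E n →L[ℝ] E n).comp (b : E n →L[ℝ] E n)),
    fun u v => by simp [s.2 (b u) (b v)]⟩

@[simp] theorem S2.pull_apply {n : ℕ} (b : GLn n) (s : S2 n) (u v : E n) :
    (S2.pull b s : E n →L[ℝ] E n →L[ℝ] E n) u v = b.symm (s.1 (b u) (b v)) := rfl

/-- The group `G²ₙ = G¹ₙ ⋊ S²ₙ` of 2-jets at `0` of local diffeomorphisms of `ℝⁿ` fixing `0`.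
The pair `(a, s)` is the 2-jet of the map `ξ ↦ a (ξ + s(ξ, ξ) / 2)`, whose first and second
derivatives at `0` are `a` and `a ∘ s`; the product is the composition of jets. -/
@[ext] structure G2 (n : ℕ) where
  lin : GLn n
  quad : S2 n

theorem S2.ext' {n : ℕ} {s t : S2 n} (h : ∀ u v, s.1 u v = t.1 u v) : s = t :=
  Subtype.ext (ContinuousLinearMap.ext fun u => ContinuousLinearMap.ext fun v => h u v)

instance {n : ℕ} : Mul (G2 n) := ⟨fun g h => ⟨g.lin * h.lin, S2.pull h.lin g.quad + h.quad⟩⟩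
instance {n : ℕ} : One (G2 n) := ⟨⟨1, 0⟩⟩
instance {n : ℕ} : Inv (G2 n) := ⟨fun g => ⟨g.lin⁻¹, -S2.pull g.lin⁻¹ g.quad⟩⟩

@[simp] theorem G2.mul_lin {n : ℕ} (g h : G2 n) : (g * h).lin = g.lin * h.lin := rfl
@[simp] theorem G2.mul_quad {n : ℕ} (g h : G2 n) :
    (g * h).quad = S2.pull h.lin g.quad + h.quad := rfl
@[simp] theorem G2.one_lin {n : ℕ} : (1 : G2 n).lin = 1 := rfl
@[simp] theorem G2.one_quad {n : ℕ} : (1 : G2 n).quad = 0 := rfl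
@[simp] theorem G2.inv_lin {n : ℕ} (g : G2 n) : (g⁻¹).lin = g.lin⁻¹ := rfl
@[simp] theorem G2.inv_quad {n : ℕ} (g : G2 n) : (g⁻¹).quad = -S2.pull g.lin⁻¹ g.quad := rfl

instance {n : ℕ} : Group (G2 n) :=
  Group.ofLeftAxioms
    (fun g h k => by
      ext1
      · rfl
      · refine S2.ext' fun u v => ?_
        change k.lin.symm (h.lin.symm _ + _) + _ = k.lin.symm (h.lin.symm _) + (k.lin.symm _ + _)
        rw [map_add, add_assoc]
        rfl)
    (fun g => by
      ext1
      · rfl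
      · refine S2.ext' fun u v => ?_
        change g.lin.symm 0 + _ = _
        simp)
    (fun g => by
      ext1
      · exact inv_mul_cancel g.lin
      · refine S2.ext' fun u v => ?_
        change g.lin.symm (-(g.lin (g.quad.1 (g.lin.symm (g.lin u)) (g.lin.symm (g.lin v)))))
          + g.quad.1 u v = 0
        simp)

/-! ### The Lie algebra of a group of matrices and its first prolongation -/

/-- The Lie algebra `𝔤` of a subgroup `G` of `GL(n, ℝ)`: the velocities at the identity of the
smooth curves in `G`. For a Lie subgroup (closed or only immersed) this is its Lie algebra, because
a curve in `G` that is smooth in `GL(n, ℝ)` is smooth in `G`. -/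
def lieAlg {n : ℕ} (G : Subgroup (GLn n)) : Submodule ℝ (E n →L[ℝ] E n) where
  carrier := {X | ∃ ε > (0 : ℝ), ∃ γ : ℝ → (E n →L[ℝ] E n),
    ContDiffOn ℝ ∞ γ (Set.Ioo (-ε) ε) ∧
    (∀ t ∈ Set.Ioo (-ε) ε, ∃ a ∈ G, (a : E n →L[ℝ] E n) = γ t) ∧
    γ 0 = ContinuousLinearMap.id ℝ (E n) ∧ HasDerivAt γ X 0}
  zero_mem' := ⟨1, one_pos, fun _ => ContinuousLinearMap.id ℝ (E n), contDiffOn_const,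
    fun _ _ => ⟨1, G.one_mem, rfl⟩, rfl, hasDerivAt_const _ _⟩
  add_mem' := by
    rintro X Y ⟨ε, hε, γ, hγ, hG, h0, hX⟩ ⟨δ, hδ, β, hβ, hH, k0, hY⟩
    have h1 : Set.Ioo (-min ε δ) (min ε δ) ⊆ Set.Ioo (-ε) ε :=
      Set.Ioo_subset_Ioo (neg_le_neg (min_le_left _ _)) (min_le_left _ _)
    have h2 : Set.Ioo (-min ε δ) (min ε δ) ⊆ Set.Ioo (-δ) δ :=
      Set.Ioo_subset_Ioo (neg_le_neg (min_le_right _ _)) (min_le_right _ _)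
    refine ⟨min ε δ, lt_min hε hδ, fun t => (γ t).comp (β t),
      (hγ.mono h1).clm_comp (hβ.mono h2), fun t ht => ?_, ?_, ?_⟩
    · obtain ⟨a, ha, ha'⟩ := hG t (h1 ht)
      obtain ⟨b, hb, hb'⟩ := hH t (h2 ht)
      exact ⟨a * b, G.mul_mem ha hb, by simp only [← ha', ← hb']; rfl⟩
    · simp [h0, k0]
    · have := hX.clm_comp hY
      rw [h0, k0] at this
      simpa using this
  smul_mem' := by
    rintro c X ⟨ε, hε, γ, hγ, hG, h0, hX⟩
    have hc : 0 < |c| + 1 := by positivity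
    have hmaps : Set.MapsTo (fun t : ℝ => c * t) (Set.Ioo (-(ε / (|c| + 1))) (ε / (|c| + 1)))
        (Set.Ioo (-ε) ε) := by
      intro t ht
      rw [Set.mem_Ioo, ← abs_lt] at ht ⊢
      rw [lt_div_iff₀ hc] at ht
      rw [abs_mul]
      nlinarith [abs_nonneg t, abs_nonneg c]
    refine ⟨ε / (|c| + 1), by positivity, fun t => γ (c * t),
      hγ.comp (by fun_prop) hmaps, fun t ht => hG _ (hmaps ht), by simp [h0], ?_⟩
    have h2 : HasDerivAt (fun t : ℝ => c * t) c 0 := by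
      simpa using (hasDerivAt_id (0 : ℝ)).const_mul c
    have h3 : HasDerivAt γ X (c * 0) := by simpa using hX
    exact h3.scomp (0 : ℝ) h2

theorem lieAlg_conj {n : ℕ} {G : Subgroup (GLn n)} {X : E n →L[ℝ] E n} (hX : X ∈ lieAlg G)
    {b : GLn n} (hb : b ∈ G) :
    ((b.symm : E n →L[ℝ] E n).comp X).comp (b : E n →L[ℝ] E n) ∈ lieAlg G := by
  obtain ⟨ε, hε, γ, hγ, hG, h0, hX⟩ := hX
  refine ⟨ε, hε, fun t => ((b.symm : E n →L[ℝ] E n).comp (γ t)).comp (b : E n →L[ℝ] E n),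
    (contDiffOn_const.clm_comp hγ).clm_comp contDiffOn_const, fun t ht => ?_, ?_, ?_⟩
  · obtain ⟨a, ha, ha'⟩ := hG t ht
    exact ⟨b⁻¹ * a * b, G.mul_mem (G.mul_mem (G.inv_mem hb) ha) hb, by simp only [← ha']; rfl⟩
  · ext1 v
    simp [h0]
  · simpa using ((hasDerivAt_const (0 : ℝ) (b.symm : E n →L[ℝ] E n)).clm_comp hX).clm_comp
      (hasDerivAt_const (0 : ℝ) (b : E n →L[ℝ] E n))

/-- The first prolongation `𝔤₁ = S²ₙ ∩ L(ℝⁿ, 𝔤)`. -/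
def prolongation {n : ℕ} (g : Submodule ℝ (E n →L[ℝ] E n)) : Submodule ℝ (S2 n) where
  carrier := {s | ∀ v, s.1 v ∈ g}
  zero_mem' := fun v => by simp
  add_mem' := fun {s t} hs ht v => by simpa using g.add_mem (hs v) (ht v)
  smul_mem' := fun c s hs v => by simpa using g.smul_mem c (hs v)

theorem pull_mem_prolongation {n : ℕ} {G : Subgroup (GLn n)} {s : S2 n}
    (hs : s ∈ prolongation (lieAlg G)) {b : GLn n} (hb : b ∈ G) :
    S2.pull b s ∈ prolongation (lieAlg G) :=
  fun v => lieAlg_conj (hs (b v)) hb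

/-- The subgroup `G ⋊ 𝔤₁` of `G²ₙ = G¹ₙ ⋊ S²ₙ`. -/
def prolongedGroup {n : ℕ} (G : Subgroup (GLn n)) : Subgroup (G2 n) where
  carrier := {g | g.lin ∈ G ∧ g.quad ∈ prolongation (lieAlg G)}
  one_mem' := ⟨G.one_mem, zero_mem _⟩
  mul_mem' := fun {_ _} hg hh =>
    ⟨G.mul_mem hg.1 hh.1, add_mem (pull_mem_prolongation hg.2 hh.1) hh.2⟩
  inv_mem' := fun {_} hg =>
    ⟨G.inv_mem hg.1, neg_mem (pull_mem_prolongation hg.2 (G.inv_mem hg.1))⟩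

section Manifold

variable {n : ℕ} {M : Type*} [TopologicalSpace M] [ChartedSpace (E n) M] [IsManifold (𝓡 n) ∞ M]

/-! ### The linear frame bundle

A linear frame at `x` is a linear isomorphism `ℝⁿ → T_x M`, so the linear frame bundle `LM = F¹M`
is the open subset of the invertible elements of the total space of the vector bundle
`Hom(ℝⁿ, TM)`. -/

variable (n M) in
/-- The total space of the smooth vector bundle `Hom(ℝⁿ, TM)` over `M`. -/
abbrev LinB : Type _ :=
  TotalSpace (E n →L[ℝ] E n) (fun x : M => Trivial M (E n) x →L[ℝ] TangentSpace (𝓡 n) x)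

/-- The model with corners of `LinB n M`. -/
abbrev IL (n : ℕ) := (𝓡 n).prod 𝓘(ℝ, E n →L[ℝ] E n)

/-- The linear map `ℝⁿ → T_x M` underlying an element of `LinB n M`. -/
def LinB.map (l : LinB n M) : E n →L[ℝ] TangentSpace (𝓡 n) l.proj := l.snd

variable (n M) in
/-- The linear frame bundle `LM`, as an open subset of `Hom(ℝⁿ, TM)`. -/
def LM : Set (LinB n M) := {l | l.map.IsInvertible}

/-- The right action of `GL(n, ℝ)`: `R_a l = l ∘ a`. -/
def rightMul (a : GLn n) (l : LinB n M) : LinB n M :=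
  ⟨l.proj, l.map.comp (a : E n →L[ℝ] E n)⟩

/-- `P` is a (first order) `G`-structure on `M`, that is, a reduction of `LM` to `G`: it is
`G`-invariant, its fibres are single `G`-orbits, and it has smooth local sections near every
point. -/
structure IsGStructure (G : Subgroup (GLn n)) (P : Set (LinB n M)) : Prop where
  subset_LM : P ⊆ LM n M
  rightMul_mem : ∀ l ∈ P, ∀ a ∈ G, rightMul a l ∈ P
  exists_rightMul : ∀ l ∈ P, ∀ l' ∈ P, l.proj = l'.proj → ∃ a ∈ G, l' = rightMul a l
  exists_section : ∀ x : M, ∃ U : Set M, IsOpen U ∧ x ∈ U ∧ ∃ σ : M → LinB n M,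
    (∀ y ∈ U, (σ y).proj = y ∧ σ y ∈ P) ∧ ContMDiffOn (𝓡 n) (IL n) ∞ σ U

/-- The tangent space `T_l P ⊆ T_l LM` of a `G`-structure: the velocities at `l` of the smooth
curves in `P`. -/
def tangentVectors (P : Set (LinB n M)) (l : LinB n M) : Set (TangentSpace (IL n) l) :=
  {X | ∃ ε > (0 : ℝ), ∃ γ : ℝ → LinB n M, ContMDiffOn 𝓘(ℝ, ℝ) (IL n) ∞ γ (Set.Ioo (-ε) ε) ∧
    (∀ t ∈ Set.Ioo (-ε) ε, γ t ∈ P) ∧ γ 0 = l ∧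
    HasMFDerivAt 𝓘(ℝ, ℝ) (IL n) γ 0 (ContinuousLinearMap.toSpanSingleton ℝ X)}

/-! ### Torsion-free transversal subspaces and symmetric connections -/

/-- The differential at `l` of the projection `LM → M`. -/
def dproj (l : LinB n M) : TangentSpace (IL n) l →L[ℝ] TangentSpace (𝓡 n) l.proj :=
  mfderiv (IL n) (𝓡 n) (TotalSpace.proj : LinB n M → M) l

/-- The canonical (soldering) form `θ` of `LM`: `θ_l(X) = l⁻¹ (dπ X)`. -/
def theta (l : LinB n M) : TangentSpace (IL n) l →L[ℝ] E n :=
  l.map.inverse.comp (dproj l)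

/-- The form `θ` read in the preferred chart of `LM` at `l₀`: the pull-back of `θ` by the inverse
of the chart. -/
def thetaChart (l₀ : LinB n M) (q : E n × (E n →L[ℝ] E n)) : E n × (E n →L[ℝ] E n) →L[ℝ] E n :=
  (theta ((extChartAt (IL n) l₀).symm q)).comp
    (mfderiv 𝓘(ℝ, E n × (E n →L[ℝ] E n)) (IL n) (extChartAt (IL n) l₀).symm q)

/-- The exterior derivative `dθ` at `l`, computed in the preferred chart at `l` by
`dω(X, Y) = (D_X ω)(Y) - (D_Y ω)(X)`. -/
def dtheta (l : LinB n M) (X Y : TangentSpace (IL n) l) : E n :=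
  let X' : E n × (E n →L[ℝ] E n) := mfderiv (IL n) 𝓘(ℝ, _) (extChartAt (IL n) l) l X
  let Y' : E n × (E n →L[ℝ] E n) := mfderiv (IL n) 𝓘(ℝ, _) (extChartAt (IL n) l) l Y
  fderiv ℝ (thetaChart l) (extChartAt (IL n) l l) X' Y'
    - fderiv ℝ (thetaChart l) (extChartAt (IL n) l l) Y' X'

/-- `H ⊆ T_l LM` is transversal: a complement of the vertical subspace (so `dim H = n`). -/
def IsTransversal (l : LinB n M) (H : Submodule ℝ (TangentSpace (IL n) l)) : Prop :=
  IsCompl H (LinearMap.ker (dproj l).toLinearMap)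

/-- `H ⊆ T_l LM` is torsion-free: `dθ` vanishes on `H`. -/
def IsTorsionFree (l : LinB n M) (H : Submodule ℝ (TangentSpace (IL n) l)) : Prop :=
  ∀ X ∈ H, ∀ Y ∈ H, dtheta l X Y = 0

/-- `H` is a symmetric connection on the `G`-structure `P`: a smooth `G`-invariant distribution
on `P` of torsion-free transversal `n`-subspaces. Only the values of `H` on `P` matter. -/
structure IsSymmetricConnection (G : Subgroup (GLn n)) (P : Set (LinB n M))
    (H : ∀ l : LinB n M, Submodule ℝ (TangentSpace (IL n) l)) : Prop where
  tangent : ∀ l ∈ P, ∀ X ∈ H l, X ∈ tangentVectors P l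
  transversal : ∀ l ∈ P, IsTransversal l (H l)
  torsionFree : ∀ l ∈ P, IsTorsionFree l (H l)
  invariant : ∀ l ∈ P, ∀ a ∈ G,
    (H l).map (mfderiv (IL n) (IL n) (rightMul a) l).toLinearMap = H (rightMul a l)
  smooth : ∀ l ∈ P, ∃ W : Set (LinB n M), IsOpen W ∧ l ∈ W ∧
    ∃ X : Fin n → ∀ p : LinB n M, TangentSpace (IL n) p,
      (∀ i, ContMDiffOn (IL n) (IL n).tangent ∞
        (fun p => (⟨p, X i p⟩ : TangentBundle (IL n) (LinB n M))) W) ∧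
      ∀ p ∈ W ∩ P, H p = Submodule.span ℝ (Set.range fun i => X i p)

/-! ### The bundle of 2-frames -/

variable (n M) in
/-- The charts of `M` whose image contains the origin. -/
abbrev OChart : Type _ :=
  {e : OpenPartialHomeomorph M (E n) // e ∈ IsManifold.maximalAtlas (𝓡 n) ∞ M ∧ (0 : E n) ∈ e.target}

/-- The inverses of the charts `e` and `e'` have the same 2-jet at `0`: the same value there and,
read in any chart around it, the same derivatives of orders one and two. -/
def SameJet (e e' : OChart n M) : Prop :=
  e.1.symm 0 = e'.1.symm 0 ∧
  ∀ c ∈ IsManifold.maximalAtlas (𝓡 n) ∞ M, e.1.symm 0 ∈ c.source →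
    fderiv ℝ (c ∘ e.1.symm) 0 = fderiv ℝ (c ∘ e'.1.symm) 0 ∧
    fderiv ℝ (fderiv ℝ (c ∘ e.1.symm)) 0 = fderiv ℝ (fderiv ℝ (c ∘ e'.1.symm)) 0

variable (n M) in
theorem sameJet_equivalence : Equivalence (SameJet : OChart n M → OChart n M → Prop) where
  refl _ := ⟨rfl, fun _ _ _ => ⟨rfl, rfl⟩⟩
  symm h := ⟨h.1.symm, fun c hc hx =>
    ⟨(h.2 c hc (h.1.symm ▸ hx)).1.symm, (h.2 c hc (h.1.symm ▸ hx)).2.symm⟩⟩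
  trans h k := ⟨h.1.trans k.1, fun c hc hx =>
    ⟨(h.2 c hc hx).1.trans (k.2 c hc (h.1 ▸ hx)).1,
      (h.2 c hc hx).2.trans (k.2 c hc (h.1 ▸ hx)).2⟩⟩

variable (n M) in
/-- Having the same 2-jet, as a setoid. -/
def jetSetoid : Setoid (OChart n M) := ⟨SameJet, sameJet_equivalence n M⟩

variable (n M) in
/-- The bundle `F²M` of 2-frames: 2-jets at `0` of inverses of charts of `M`. -/
def Frame2 : Type _ := Quotient (jetSetoid n M)

/-- The 2-frame given by a chart. -/
def Frame2.mk (e : OChart n M) : Frame2 n M := Quotient.mk (jetSetoid n M) e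

/-- The projection `F²M → M`. -/
def Frame2.proj (z : Frame2 n M) : M :=
  Quotient.lift (s := jetSetoid n M) (fun e : OChart n M => e.1.symm 0)
    (fun _ _ (h : SameJet _ _) => h.1) z

/-- The first and second partial derivatives of a 2-frame with respect to a chart `c`. For `c` in
the maximal atlas with `z.proj ∈ c.source` they do not depend on the representative, and together
with `c z.proj` they are the coordinates on `F²M` induced by `c`. -/
def Frame2.coord (c : OpenPartialHomeomorph M (E n)) (z : Frame2 n M) :
    (E n →L[ℝ] E n) × (E n →L[ℝ] E n →L[ℝ] E n) :=
  (fderiv ℝ (c ∘ (Quotient.out z).1.symm) 0,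
    fderiv ℝ (fderiv ℝ (c ∘ (Quotient.out z).1.symm)) 0)

/-- `σ` is a smooth section of `F²M` over the open set `U`: its coordinates with respect to every
chart of `M` are smooth. -/
def IsSmoothSection (σ : M → Frame2 n M) (U : Set M) : Prop :=
  (∀ y ∈ U, (σ y).proj = y) ∧
  ∀ c ∈ IsManifold.maximalAtlas (𝓡 n) ∞ M,
    ContMDiffOn (𝓡 n) 𝓘(ℝ, (E n →L[ℝ] E n) × (E n →L[ℝ] E n →L[ℝ] E n)) ∞
      (fun y => Frame2.coord c (σ y)) (U ∩ c.source)

/-! ### The right action of `G²ₙ` on `F²M` -/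

/-- The polynomial map `ξ ↦ a (ξ + s(ξ, ξ) / 2)` with 2-jet `(a, s)` at `0`. -/
def G2.poly (g : G2 n) (ξ : E n) : E n := g.lin (ξ + (1 / 2 : ℝ) • g.quad.1 ξ ξ)

theorem G2.contDiff_poly (g : G2 n) : ContDiff ℝ ∞ g.poly := by
  unfold G2.poly
  fun_prop

theorem G2.hasFDerivAt_poly (g : G2 n) : HasFDerivAt g.poly (g.lin : E n →L[ℝ] E n) 0 := by
  have h1 : HasFDerivAt (fun ξ : E n => g.quad.1 ξ ξ) (0 : E n →L[ℝ] E n) 0 := by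
    have := (g.quad.1.hasFDerivAt (x := (0 : E n))).clm_apply (hasFDerivAt_id (0 : E n))
    have h0 : (g.quad.1 0).comp (ContinuousLinearMap.id ℝ (E n)) + g.quad.1.flip (id (0 : E n))
        = 0 := by
      ext1 v
      simp
    exact h0 ▸ this
  have h2 := g.lin.hasFDerivAt.comp (0 : E n)
    ((hasFDerivAt_id (0 : E n)).add (h1.const_smul (1 / 2 : ℝ)))
  have h3 : (g.lin : E n →L[ℝ] E n).comp
      (ContinuousLinearMap.id ℝ (E n) + (1 / 2 : ℝ) • (0 : E n →L[ℝ] E n)) = g.lin := by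
    ext1 v
    simp
  exact h3 ▸ h2

/-- `G2.poly` as a local diffeomorphism around `0`, restricted to a neighbourhood of `0` where its
derivative is invertible. -/
def G2.diffeo (g : G2 n) : OpenPartialHomeomorph (E n) (E n) :=
  ((g.contDiff_poly.contDiffAt (x := 0)).toOpenPartialHomeomorph g.poly g.hasFDerivAt_poly
    (by simp)).restrOpen
    (fderiv ℝ g.poly ⁻¹' Set.range ((↑) : (E n ≃L[ℝ] E n) → (E n →L[ℝ] E n)))
    (ContinuousLinearEquiv.isOpen.preimage (g.contDiff_poly.continuous_fderiv (by simp)))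

theorem G2.coe_diffeo (g : G2 n) : ⇑g.diffeo = g.poly := rfl

theorem G2.poly_zero (g : G2 n) : g.poly 0 = 0 := by simp [G2.poly]

theorem G2.zero_mem_source (g : G2 n) : (0 : E n) ∈ g.diffeo.source := by
  refine ⟨(g.contDiff_poly.contDiffAt (x := 0)).mem_toOpenPartialHomeomorph_source
    g.hasFDerivAt_poly (by simp), ⟨g.lin, g.hasFDerivAt_poly.fderiv.symm⟩⟩

theorem G2.contDiffOn_diffeo_symm (g : G2 n) :
    ContDiffOn ℝ ∞ g.diffeo.symm g.diffeo.target := by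
  refine fun y hy => ContDiffAt.contDiffWithinAt ?_
  have hs : g.diffeo.symm y ∈ g.diffeo.source := g.diffeo.map_target hy
  obtain ⟨A, hA⟩ := hs.2
  refine g.diffeo.contDiffAt_symm (f₀' := A) hy ?_ g.contDiff_poly.contDiffAt
  rw [hA]
  exact (g.contDiff_poly.differentiable (by simp) _).hasFDerivAt

/-- The chart `φ⁻¹ ∘ e`, whose inverse is `e⁻¹ ∘ φ`, where `φ` is the local diffeomorphism with
2-jet `g`. -/
def OChart.act (e : OChart n M) (g : G2 n) : OChart n M :=
  ⟨e.1.trans g.diffeo.symm, by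
    constructor
    · have he := (IsManifold.mem_maximalAtlas_iff_contMDiffOn e.1).1 e.2.1
      rw [IsManifold.mem_maximalAtlas_iff_contMDiffOn]
      constructor
      · exact (contMDiffOn_iff_contDiffOn.2 g.contDiffOn_diffeo_symm).comp
          (he.1.mono (by simp [Set.inter_subset_left])) (by simp)
      · refine he.2.comp ((contMDiffOn_iff_contDiffOn.2
          g.contDiff_poly.contDiffOn).mono (Set.subset_univ _)) ?_
        intro x hx
        simpa [G2.coe_diffeo] using hx.2
    · have h0 := g.zero_mem_source
      simpa [G2.coe_diffeo, G2.poly_zero, h0] using e.2.2⟩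

theorem OChart.act_symm (e : OChart n M) (g : G2 n) :
    ⇑(e.act g).1.symm = e.1.symm ∘ g.poly := rfl

/-- The 2-jet at `0` of `F ∘ φ` is determined by the 2-jet of `F`. -/
theorem jet_comp {F F' φ : E n → E n} (hF : ContDiffAt ℝ ∞ F 0) (hF' : ContDiffAt ℝ ∞ F' 0)
    (hφ : ContDiff ℝ ∞ φ) (h0 : φ 0 = 0) (h1 : fderiv ℝ F 0 = fderiv ℝ F' 0)
    (h2 : fderiv ℝ (fderiv ℝ F) 0 = fderiv ℝ (fderiv ℝ F') 0) :
    fderiv ℝ (F ∘ φ) 0 = fderiv ℝ (F' ∘ φ) 0 ∧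
      fderiv ℝ (fderiv ℝ (F ∘ φ)) 0 = fderiv ℝ (fderiv ℝ (F' ∘ φ)) 0 := by
  have key : ∀ {F : E n → E n}, ContDiffAt ℝ ∞ F 0 →
      fderiv ℝ (F ∘ φ) =ᶠ[𝓝 0] (fun x => (fderiv ℝ F (φ x)).comp (fderiv ℝ φ x)) ∧
      HasFDerivAt (fderiv ℝ F) (fderiv ℝ (fderiv ℝ F) 0) (φ 0) := by
    intro F hF
    constructor
    · have hev : ∀ᶠ x in 𝓝 (0 : E n), DifferentiableAt ℝ F x := by
        have := (hF.of_le (m := 1) (by simp)).eventually (by simp)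
        exact this.mono fun x hx => hx.differentiableAt (by simp)
      have ht : Filter.Tendsto φ (𝓝 0) (𝓝 0) := by
        simpa [h0] using hφ.continuous.tendsto 0
      filter_upwards [ht.eventually hev] with x hx
      exact fderiv_comp x hx (hφ.differentiable (by simp) x)
    · rw [h0]
      exact ((hF.fderiv_right (m := 1) (by rw [one_add_one_eq_two]; exact ENat.LEInfty.out)).differentiableAt (by simp)).hasFDerivAt
  have hd : HasFDerivAt (fderiv ℝ φ) (fderiv ℝ (fderiv ℝ φ) 0) 0 :=
    ((hφ.contDiffAt.fderiv_right (m := 1) (by rw [one_add_one_eq_two]; exact ENat.LEInfty.out)).differentiableAt (by simp)).hasFDerivAt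
  have hφ1 : HasFDerivAt φ (fderiv ℝ φ 0) 0 := (hφ.differentiable (by simp) 0).hasFDerivAt
  obtain ⟨k1, k2⟩ := key hF
  obtain ⟨k1', k2'⟩ := key hF'
  refine ⟨?_, ?_⟩
  · rw [k1.self_of_nhds, k1'.self_of_nhds]
    simp only [h0, h1]
  · rw [k1.fderiv_eq, k1'.fderiv_eq]
    refine ((k2.comp 0 hφ1).clm_comp hd).fderiv.trans
      (Eq.trans ?_ ((k2'.comp 0 hφ1).clm_comp hd).fderiv.symm)
    simp only [Function.comp_apply, h0, h1, h2]

theorem contDiffAt_chart_comp (e : OChart n M) {c : OpenPartialHomeomorph M (E n)}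
    (hc : c ∈ IsManifold.maximalAtlas (𝓡 n) ∞ M) (hx : e.1.symm 0 ∈ c.source) :
    ContDiffAt ℝ ∞ (c ∘ e.1.symm) 0 :=
  contMDiffAt_iff_contDiffAt.1
    ((contMDiffAt_of_mem_maximalAtlas hc hx).comp 0
      (contMDiffAt_symm_of_mem_maximalAtlas e.2.1 e.2.2))

theorem SameJet.act {e e' : OChart n M} (h : SameJet e e') (g : G2 n) :
    SameJet (e.act g) (e'.act g) := by
  refine ⟨?_, fun c hc hx => ?_⟩
  · simpa [OChart.act_symm, G2.poly_zero] using h.1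
  · have hx' : e.1.symm 0 ∈ c.source := by simpa [OChart.act_symm, G2.poly_zero] using hx
    exact jet_comp (contDiffAt_chart_comp e hc hx') (contDiffAt_chart_comp e' hc (h.1 ▸ hx'))
      g.contDiff_poly g.poly_zero (h.2 c hc hx').1 (h.2 c hc hx').2

/-- The right action of `G²ₙ` on `F²M` by composition of 2-jets. -/
def Frame2.act (z : Frame2 n M) (g : G2 n) : Frame2 n M :=
  Quotient.map' (s₁ := jetSetoid n M) (s₂ := jetSetoid n M) (fun e => OChart.act e g)
    (fun _ _ h => SameJet.act h g) z

/-- `Q` is a second order `K`-structure on `M`, that is, a reduction of `F²M` to the subgroup `K`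
of `G²ₙ`: it is `K`-invariant, its fibres are single `K`-orbits, and it has smooth local sections
near every point. -/
structure IsSecondOrderStructure (K : Subgroup (G2 n)) (Q : Set (Frame2 n M)) : Prop where
  act_mem : ∀ z ∈ Q, ∀ g ∈ K, z.act g ∈ Q
  exists_act : ∀ z ∈ Q, ∀ z' ∈ Q, z.proj = z'.proj → ∃ g ∈ K, z' = z.act g
  exists_section : ∀ x : M, ∃ U : Set M, IsOpen U ∧ x ∈ U ∧ ∃ σ : M → Frame2 n M,
    (∀ y ∈ U, σ y ∈ Q) ∧ IsSmoothSection σ U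

/-! ### The 2-frames of a `G`-structure -/

/-- The coordinate frame field of a chart `e`, composed with its inverse:
`ξ ↦ (d(e⁻¹)_ξ : ℝⁿ → T_{e⁻¹(ξ)} M)`. -/
def frameField (e : OChart n M) (ξ : E n) : LinB n M :=
  ⟨e.1.symm ξ, mfderiv 𝓘(ℝ, E n) (𝓡 n) e.1.symm ξ⟩

/-- The `n`-subspace of `T_l LM`, `l = frameField e 0`, corresponding to the 2-frame given by the
chart `e`: the image of the differential at `0` of its coordinate frame field. -/
def chartSubspace (e : OChart n M) : Submodule ℝ (TangentSpace (IL n) (frameField e 0)) :=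
  LinearMap.range (mfderiv 𝓘(ℝ, E n) (IL n) (frameField e) 0).toLinearMap

/-- The set `P²` of the 2-frames whose corresponding torsion-free transversal `n`-subspace is
included in `TP`: its base frame `l` lies in `P` and the subspace lies in `T_l P`. -/
def holonomicProlongation (P : Set (LinB n M)) : Set (Frame2 n M) :=
  {z | ∃ e : OChart n M, Frame2.mk e = z ∧ frameField e 0 ∈ P ∧
    ∀ X ∈ chartSubspace e, X ∈ tangentVectors P (frameField e 0)}

end Manifold

end GStr

end

/-!
Near a frame `l₀` of `P`, use the coordinates `(x, A)` of `LM` induced by a chart `c` of `M`, where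
`A` is the matrix of the frame. For a chart `e` with `e⁻¹(0)` close to the base point, put
`F = c ∘ e⁻¹`. The frame field of `e` has the coordinates `(F, dF)`, so the subspace given by `e`
is `{(dF u, d²F u)}` at `0` (`mfderiv_frameField`).

A local section `s` of `P` describes the tangent vectors of `P` at `l = l₀ ∘ a`, `a ∈ G`: they are
the `(v, B)` with `B - (ds v) a ∈ l₀ ∘ a ∘ 𝔤` (`IsGStructure.mem_tangentVectors_iff`), because every
curve in `P` is `s` along the projected curve, moved by a smooth curve in `G`. Hence `e` is adapted
to `P` exactly if `d²F u - (ds (dF u)) a` lies in `l₀ ∘ a ∘ 𝔤` for all `u`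
(`IsGStructure.exists_isAdapted_iff`).

* The second order chain rule for `e⁻¹ ∘ φ`, with `φ` of 2-jet `(b, t)`, adds `t` to the `𝔤`-valued
  part of the second derivative, after conjugation by `b`. So `P²` is invariant under `G ⋊ 𝔤₁`
  (`IsAdapted.act`).
* For two adapted charts at the same point the terms with `ds` cancel, and the difference of
  their second derivatives is a symmetric map with values in `𝔤` (`IsAdapted.exists_act`).
* A transversal subspace at `l` is `{(v, Γ v)}`, and `dθ` vanishes on it exactly if
  `l⁻¹ Γ(l u) v` is symmetric in `u` and `v` (`dtheta_eq`). It is then the second order part of the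
  2-jet of the inverse of a chart, so the subspaces of the connection along a local section of `P`
  come from 2-frames in `P²` (`exists_chart_of_isTorsionFree`). These depend smoothly on the point:
  if `(V, B)` are the coordinates of smooth vector fields spanning the connection, then
  `d²F = B V⁻¹ dF` (`contMDiffAt_of_sum_smul`, `contMDiffAt_coord_mk`).
-/

noncomputable section

namespace GStr

open Filter

section Manifold

variable {n : ℕ} {M : Type*} [TopologicalSpace M] [ChartedSpace (E n) M] [IsManifold (𝓡 n) ∞ M]

/-! ### Coordinates on the linear frame bundle -/

theorem mem_extChartAt_source_linB (l₀ l : LinB n M) :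
    l ∈ (extChartAt (IL n) l₀).source ↔ l.proj ∈ (chartAt (E n) l₀.proj).source := by
  rw [extChartAt_source, FiberBundle.chartedSpace_chartAt]
  refine ⟨fun h => h.2.1, fun h => ⟨⟨Set.mem_univ _, h⟩, h, Set.mem_univ _⟩⟩

/-- The preferred chart of `LM` at `l₀` sends a frame `l` at `x` to the pair of `c x` and
`dc ∘ l`, where `c` is the preferred chart of `M` at the base point of `l₀`. -/
theorem extChartAt_linB {l₀ l : LinB n M} (h : l.proj ∈ (chartAt (E n) l₀.proj).source) :
    extChartAt (IL n) l₀ l = (chartAt (E n) l₀.proj l.proj,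
      (mfderiv (𝓡 n) 𝓘(ℝ, E n) (chartAt (E n) l₀.proj) l.proj).comp l.map) := by
  rw [FiberBundle.extChartAt]
  refine Prod.ext rfl ?_
  change ContinuousLinearMap.inCoordinates (E n) (Trivial M (E n)) (E n) (TangentSpace (𝓡 n))
    l₀.proj l.proj l₀.proj l.proj l.snd = _
  rw [ContinuousLinearMap.inCoordinates, TangentBundle.continuousLinearMapAt_trivializationAt h]
  have : (trivializationAt (E n) (Trivial M (E n)) l₀.proj).symmL ℝ l.proj =
      ContinuousLinearMap.id ℝ (E n) :=
    Bundle.Trivial.symmL_trivialization ..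
  rw [this]
  rfl

/-- The matrix of a frame in the preferred chart of `M` at its base point. -/
def LinB.mat (l : LinB n M) : E n →L[ℝ] E n := l.map

theorem extChartAt_self (l : LinB n M) :
    extChartAt (IL n) l l = (chartAt (E n) l.proj l.proj, l.mat) := by
  rw [extChartAt_linB (mem_chart_source _ _)]
  have := mfderiv_extChartAt_self (I := 𝓡 n) (x := l.proj)
  rw [show mfderiv (𝓡 n) 𝓘(ℝ, E n) (chartAt (E n) l.proj) l.proj =
    ContinuousLinearMap.id ℝ (E n) from this]
  rfl

theorem linB_ext {l₀ l l' : LinB n M} (h : l.proj ∈ (chartAt (E n) l₀.proj).source)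
    (h' : l'.proj ∈ (chartAt (E n) l₀.proj).source)
    (H : extChartAt (IL n) l₀ l = extChartAt (IL n) l₀ l') : l = l' :=
  (extChartAt (IL n) l₀).injOn ((mem_extChartAt_source_linB _ _).2 h)
    ((mem_extChartAt_source_linB _ _).2 h') H

theorem mem_extChartAt_target_linB (l₀ : LinB n M) (q : E n × (E n →L[ℝ] E n)) :
    q ∈ (extChartAt (IL n) l₀).target ↔ q.1 ∈ (chartAt (E n) l₀.proj).target := by
  rw [FiberBundle.extChartAt_target]
  refine ⟨fun h => ?_, fun h => ⟨⟨?_, Set.mem_univ _, ?_⟩, Set.mem_univ _⟩⟩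
  · simpa using h.1.1
  · simpa using h
  · exact (chartAt (E n) l₀.proj).map_target h

theorem proj_extChartAt_symm {l₀ : LinB n M} {q : E n × (E n →L[ℝ] E n)}
    (h : q.1 ∈ (chartAt (E n) l₀.proj).target) :
    ((extChartAt (IL n) l₀).symm q).proj = (chartAt (E n) l₀.proj).symm q.1 := by
  have h1 := (extChartAt (IL n) l₀).map_target ((mem_extChartAt_target_linB l₀ q).2 h)
  rw [mem_extChartAt_source_linB] at h1
  have h2 := extChartAt_linB h1
  rw [(extChartAt (IL n) l₀).right_inv ((mem_extChartAt_target_linB l₀ q).2 h)] at h2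
  rw [congrArg Prod.fst h2]
  exact ((chartAt (E n) l₀.proj).left_inv h1).symm

theorem rightMul_coord {l₀ l : LinB n M} (h : l.proj ∈ (chartAt (E n) l₀.proj).source) (a : GLn n) :
    extChartAt (IL n) l₀ (rightMul a l) =
      ((extChartAt (IL n) l₀ l).1, (extChartAt (IL n) l₀ l).2.comp (a : E n →L[ℝ] E n)) := by
  rw [extChartAt_linB h, extChartAt_linB (l := rightMul a l) h]
  rfl

/-- With `F = c ∘ e⁻¹`, the frame field of `e` has the coordinates `(F, dF)`. -/
theorem extChartAt_frameField {l₀ : LinB n M} (e : OChart n M)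
    (h : e.1.symm 0 ∈ (chartAt (E n) l₀.proj).source) :
    (fun ξ => extChartAt (IL n) l₀ (frameField e ξ)) =ᶠ[𝓝 0]
      fun ξ => ((chartAt (E n) l₀.proj ∘ e.1.symm) ξ,
        fderiv ℝ (chartAt (E n) l₀.proj ∘ e.1.symm) ξ) := by
  have h1 : ∀ᶠ ξ in 𝓝 (0 : E n), ξ ∈ e.1.target := e.1.open_target.mem_nhds e.2.2
  have h2 : ∀ᶠ ξ in 𝓝 (0 : E n), e.1.symm ξ ∈ (chartAt (E n) l₀.proj).source :=
    (e.1.continuousAt_symm e.2.2).eventually ((chartAt (E n) l₀.proj).open_source.mem_nhds h)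
  filter_upwards [h1, h2] with ξ h1 h2
  rw [extChartAt_linB (l := frameField e ξ) h2, ← mfderiv_eq_fderiv]
  refine Prod.ext rfl ?_
  have := mfderiv_comp (I := 𝓘(ℝ, E n)) (I' := 𝓡 n) (I'' := 𝓘(ℝ, E n)) ξ
    ((contMDiffAt_of_mem_maximalAtlas (I := 𝓡 n) (n := ∞)
      (IsManifold.chart_mem_maximalAtlas l₀.proj) h2).mdifferentiableAt (by simp))
    ((contMDiffAt_symm_of_mem_maximalAtlas e.2.1 h1).mdifferentiableAt (by simp))
  rw [this]
  rfl

theorem contDiffAt_fderiv {F F' : Type*} [NormedAddCommGroup F] [NormedSpace ℝ F]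
    [NormedAddCommGroup F'] [NormedSpace ℝ F'] {f : F → F'} {x : F} (hf : ContDiffAt ℝ ∞ f x) :
    ContDiffAt ℝ ∞ (fderiv ℝ f) x :=
  hf.fderiv_right (m := ∞) (by simp)

/-- A map into `LM` whose coordinates are smooth is smooth; continuity need not be assumed, only
that the base points stay in the domain of the chart. -/
theorem contMDiffAt_of_coord {F : Type*} [NormedAddCommGroup F] [NormedSpace ℝ F] {f : F → LinB n M}
    {x : F} (l₀ : LinB n M) (hs : ∀ᶠ ξ in 𝓝 x, (f ξ).proj ∈ (chartAt (E n) l₀.proj).source)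
    (hf : ContDiffAt ℝ ∞ (fun ξ => extChartAt (IL n) l₀ (f ξ)) x) :
    ContMDiffAt 𝓘(ℝ, F) (IL n) ∞ f x := by
  have h1 : f =ᶠ[𝓝 x] (extChartAt (IL n) l₀).symm ∘ fun ξ => extChartAt (IL n) l₀ (f ξ) := by
    filter_upwards [hs] with ξ hξ
    exact ((extChartAt (IL n) l₀).left_inv ((mem_extChartAt_source_linB _ _).2 hξ)).symm
  refine ContMDiffAt.congr_of_eventuallyEq ?_ h1
  have h2 := (mem_extChartAt_source_linB l₀ (f x)).2 hs.self_of_nhds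
  have h3 : ContMDiffAt 𝓘(ℝ, E n × (E n →L[ℝ] E n)) (IL n) ∞ (extChartAt (IL n) l₀).symm
      (extChartAt (IL n) l₀ (f x)) :=
    (contMDiffOn_extChartAt_symm l₀).contMDiffAt
      (extChartAt_target_mem_nhds' ((extChartAt (IL n) l₀).map_source h2))
  exact h3.comp x hf.contMDiffAt

theorem chartAt_comp_contDiffAt {x : M} (e : OChart n M)
    (h : e.1.symm 0 ∈ (chartAt (E n) x).source) :
    ContDiffAt ℝ ∞ (chartAt (E n) x ∘ e.1.symm) 0 :=
  contDiffAt_chart_comp e (IsManifold.chart_mem_maximalAtlas x) h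

theorem contDiffAt_coord_frameField {l₀ : LinB n M} (e : OChart n M)
    (h : e.1.symm 0 ∈ (chartAt (E n) l₀.proj).source) :
    ContDiffAt ℝ ∞ (fun ξ => extChartAt (IL n) l₀ (frameField e ξ)) 0 :=
  ((chartAt_comp_contDiffAt e h).prodMk
    (contDiffAt_fderiv (chartAt_comp_contDiffAt e h))).congr_of_eventuallyEq
      (extChartAt_frameField e h)

theorem eventually_frameField_mem {x : M} (e : OChart n M)
    (h : e.1.symm 0 ∈ (chartAt (E n) x).source) :
    ∀ᶠ ξ in 𝓝 (0 : E n), (frameField e ξ).proj ∈ (chartAt (E n) x).source :=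
  (e.1.continuousAt_symm e.2.2).eventually ((chartAt (E n) x).open_source.mem_nhds h)

/-- The differential at `0` of the frame field of `e`, read in the chart of `LM` at `l₀`, is
`u ↦ (dF u, d²F u)` with `F = c ∘ e⁻¹`. -/
theorem mfderiv_frameField {l₀ : LinB n M} (e : OChart n M)
    (h : e.1.symm 0 ∈ (chartAt (E n) l₀.proj).source) (u : E n) :
    mfderiv (IL n) 𝓘(ℝ, E n × (E n →L[ℝ] E n)) (extChartAt (IL n) l₀) (frameField e 0)
      (mfderiv 𝓘(ℝ, E n) (IL n) (frameField e) 0 u) =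
      (fderiv ℝ (chartAt (E n) l₀.proj ∘ e.1.symm) 0 u,
        fderiv ℝ (fderiv ℝ (chartAt (E n) l₀.proj ∘ e.1.symm)) 0 u) := by
  have h1 : MDifferentiableAt 𝓘(ℝ, E n) (IL n) (frameField e) 0 :=
    (contMDiffAt_of_coord l₀ (eventually_frameField_mem e h)
      (contDiffAt_coord_frameField e h)).mdifferentiableAt (by simp)
  have h2 : MDifferentiableAt (IL n) 𝓘(ℝ, E n × (E n →L[ℝ] E n)) (extChartAt (IL n) l₀)
      (frameField e 0) := by
    refine mdifferentiableAt_extChartAt ?_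
    rw [← extChartAt_source (IL n), mem_extChartAt_source_linB]
    exact h
  have h3 := mfderiv_comp (0 : E n) h2 h1
  have h4 : mfderiv 𝓘(ℝ, E n) 𝓘(ℝ, E n × (E n →L[ℝ] E n))
      (extChartAt (IL n) l₀ ∘ frameField e) 0 =
      (fderiv ℝ (chartAt (E n) l₀.proj ∘ e.1.symm) 0).prod
        (fderiv ℝ (fderiv ℝ (chartAt (E n) l₀.proj ∘ e.1.symm)) 0) := by
    rw [mfderiv_eq_fderiv]
    refine (extChartAt_frameField e h).fderiv_eq.trans ?_
    exact ((chartAt_comp_contDiffAt e h).differentiableAt (by simp)).fderiv_prodMk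
      ((contDiffAt_fderiv (chartAt_comp_contDiffAt e h)).differentiableAt (by simp))
  rw [h4] at h3
  exact (DFunLike.congr_fun h3 u).symm

theorem mfderiv_frameField_self (e : OChart n M) (u : E n) :
    mfderiv 𝓘(ℝ, E n) (IL n) (frameField e) 0 u =
      (fderiv ℝ (chartAt (E n) (e.1.symm 0) ∘ e.1.symm) 0 u,
        fderiv ℝ (fderiv ℝ (chartAt (E n) (e.1.symm 0) ∘ e.1.symm)) 0 u) := by
  have h := mfderiv_frameField (l₀ := frameField e 0) e (mem_chart_source _ _) u
  rw [mfderiv_extChartAt_self] at h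
  exact h

/-! ### Second derivatives of compositions -/

section Jets

variable {F₁ F₂ F₃ : Type*} [NormedAddCommGroup F₁] [NormedSpace ℝ F₁] [NormedAddCommGroup F₂]
  [NormedSpace ℝ F₂] [NormedAddCommGroup F₃] [NormedSpace ℝ F₃]

/-- The second order chain rule. -/
theorem fderiv_fderiv_comp {f : F₂ → F₃} {g : F₁ → F₂} {x : F₁} (hf : ContDiffAt ℝ ∞ f (g x))
    (hg : ContDiffAt ℝ ∞ g x) (u v : F₁) :
    fderiv ℝ (fderiv ℝ (f ∘ g)) x u v =
      fderiv ℝ (fderiv ℝ f) (g x) (fderiv ℝ g x u) (fderiv ℝ g x v) +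
        fderiv ℝ f (g x) (fderiv ℝ (fderiv ℝ g) x u v) := by
  have h1 : fderiv ℝ (f ∘ g) =ᶠ[𝓝 x] fun y => (fderiv ℝ f (g y)).comp (fderiv ℝ g y) := by
    have hf' : ∀ᶠ z in 𝓝 (g x), DifferentiableAt ℝ f z :=
      ((hf.of_le (m := 1) (by simp)).eventually (by simp)).mono
        fun z hz => hz.differentiableAt (by simp)
    have hg' : ∀ᶠ y in 𝓝 x, DifferentiableAt ℝ g y :=
      ((hg.of_le (m := 1) (by simp)).eventually (by simp)).mono
        fun z hz => hz.differentiableAt (by simp)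
    filter_upwards [hg.continuousAt.eventually hf', hg'] with y hy hy'
    exact fderiv_comp y hy hy'
  have h2 : HasFDerivAt (fun y => fderiv ℝ f (g y))
      ((fderiv ℝ (fderiv ℝ f) (g x)).comp (fderiv ℝ g x)) x :=
    ((contDiffAt_fderiv hf).differentiableAt (by simp)).hasFDerivAt.comp x
      (hg.differentiableAt (by simp)).hasFDerivAt
  have h3 : HasFDerivAt (fderiv ℝ g) (fderiv ℝ (fderiv ℝ g) x) x :=
    ((contDiffAt_fderiv hg).differentiableAt (by simp)).hasFDerivAt
  rw [h1.fderiv_eq, (h2.clm_comp h3).fderiv]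
  simp [add_comm]

end Jets

theorem G2.fderiv_poly (g : G2 n) (ξ u : E n) :
    fderiv ℝ g.poly ξ u = g.lin (u + g.quad.1 ξ u) := by
  have h1 : HasFDerivAt (fun ξ : E n => g.quad.1 ξ ξ) _ ξ :=
    (g.quad.1.hasFDerivAt (x := ξ)).clm_apply (hasFDerivAt_id ξ)
  have h2 := g.lin.hasFDerivAt.comp ξ ((hasFDerivAt_id ξ).add (h1.const_smul (1 / 2 : ℝ)))
  have h3 : HasFDerivAt g.poly _ ξ := h2
  rw [h3.fderiv]
  simp [g.quad.2 u ξ]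
  rw [← two_smul ℝ, smul_smul]
  norm_num

theorem G2.fderiv_fderiv_poly (g : G2 n) (u v : E n) :
    fderiv ℝ (fderiv ℝ g.poly) 0 u v = g.lin (g.quad.1 u v) := by
  have h : fderiv ℝ g.poly = fun ξ => (g.lin : E n →L[ℝ] E n) +
      (ContinuousLinearMap.compL ℝ (E n) (E n) (E n) (g.lin : E n →L[ℝ] E n)).comp g.quad.1 ξ := by
    ext ξ u
    simp [G2.fderiv_poly]
  rw [h, fderiv_const_add, ContinuousLinearMap.fderiv]
  rfl

/-! ### Tangent vectors of a `G`-structure -/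

theorem extChartAt_congr_proj {l l' : LinB n M} (h : l.proj = l'.proj) :
    extChartAt (IL n) l = extChartAt (IL n) l' := by
  rw [FiberBundle.extChartAt, FiberBundle.extChartAt, h]

theorem hasMFDerivAt_linB_iff {F : Type*} [NormedAddCommGroup F] [NormedSpace ℝ F]
    {f : F → LinB n M} {x : F} {f' : F →L[ℝ] E n × (E n →L[ℝ] E n)} :
    HasMFDerivAt 𝓘(ℝ, F) (IL n) f x f' ↔
      ContinuousAt f x ∧ HasFDerivAt (fun t => extChartAt (IL n) (f x) (f t)) f' x := by
  unfold HasMFDerivAt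
  refine and_congr_right fun _ => ?_
  rw [← hasFDerivWithinAt_univ]
  simp only [writtenInExtChartAt, mfld_simps]
  rfl

/-- A smooth section `s` of `P` over the open set `V`, read in the preferred chart around `l₀`: it
passes through `l₀`, and the points of `P` over `x ∈ V` have the matrices `s x ∘ a` with `a ∈ G`. -/
structure IsChartSection (G : Subgroup (GLn n)) (P : Set (LinB n M)) (l₀ : LinB n M)
    (V : Set (E n)) (s : E n → E n →L[ℝ] E n) : Prop where
  isOpen : IsOpen V
  base_mem : chartAt (E n) l₀.proj l₀.proj ∈ V
  subset_target : V ⊆ (chartAt (E n) l₀.proj).target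
  contDiffOn : ContDiffOn ℝ ∞ s V
  apply_base : s (chartAt (E n) l₀.proj l₀.proj) = l₀.mat
  isInvertible : ∀ x ∈ V, (s x).IsInvertible
  mem_iff : ∀ x ∈ V, ∀ A, (extChartAt (IL n) l₀).symm (x, A) ∈ P ↔
    ∃ a ∈ G, A = (s x).comp (a : E n →L[ℝ] E n)

theorem IsGStructure.exists_isChartSection {G : Subgroup (GLn n)} {P : Set (LinB n M)}
    (hP : IsGStructure G P) {l₀ : LinB n M} (hl₀ : l₀ ∈ P) :
    ∃ V s, IsChartSection G P l₀ V s := by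
  obtain ⟨U, hU, hyU, σ, hσ, hσs⟩ := hP.exists_section l₀.proj
  obtain ⟨g, hg, hg'⟩ := hP.exists_rightMul _ (hσ _ hyU).2 _ hl₀ (hσ _ hyU).1
  set c := chartAt (E n) l₀.proj with hc
  have hyc : l₀.proj ∈ c.source := mem_chart_source _ _
  set τ : E n → LinB n M := fun x => rightMul g (σ (c.symm x)) with hτ
  have hτp : ∀ x ∈ c.target ∩ c.symm ⁻¹' U, (τ x).proj = c.symm x := fun x hx => (hσ _ hx.2).1
  have hτc : ∀ x ∈ c.target ∩ c.symm ⁻¹' U, (τ x).proj ∈ c.source := fun x hx => by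
    rw [hτp x hx]; exact c.map_target hx.1
  have hτ1 : ∀ x ∈ c.target ∩ c.symm ⁻¹' U, (extChartAt (IL n) l₀ (τ x)).1 = x := fun x hx => by
    rw [extChartAt_linB (hτc x hx)]
    change c (τ x).proj = x
    rw [hτp x hx, c.right_inv hx.1]
  have hτP : ∀ x ∈ c.target ∩ c.symm ⁻¹' U, τ x ∈ P := fun x hx =>
    hP.rightMul_mem _ (hσ _ hx.2).2 _ hg
  refine ⟨c.target ∩ c.symm ⁻¹' U, fun x => (extChartAt (IL n) l₀ (τ x)).2,
    c.isOpen_inter_preimage_symm hU, ⟨c.map_source hyc, ?_⟩, Set.inter_subset_left, ?_, ?_, ?_, ?_⟩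
  · change c.symm (c l₀.proj) ∈ U
    rwa [c.left_inv hyc]
  · have h1 : ContMDiffOn 𝓘(ℝ, E n) 𝓘(ℝ, E n × (E n →L[ℝ] E n)) ∞
        (fun x => extChartAt (IL n) l₀ (σ (c.symm x))) (c.target ∩ c.symm ⁻¹' U) := by
      refine (contMDiffOn_extChartAt (I := IL n) (n := ∞) (x := l₀)).comp
        (hσs.comp ((contMDiffOn_chart_symm (I := 𝓡 n) (x := l₀.proj)).mono
          Set.inter_subset_left) fun x hx => hx.2) fun x hx => ?_
      rw [← extChartAt_source (IL n)]
      exact (mem_extChartAt_source_linB _ _).2 (hτc x hx)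
    have h2 := (contMDiffOn_iff_contDiffOn.1 h1).snd.clm_comp
      (contDiffOn_const (c := (g : E n →L[ℝ] E n)))
    refine h2.congr fun x hx => ?_
    exact congrArg Prod.snd (rightMul_coord (l := σ (c.symm x)) (hτc x hx) g)
  · change (extChartAt (IL n) l₀ (rightMul g (σ (c.symm (c l₀.proj))))).2 = _
    rw [c.left_inv hyc, ← hg', extChartAt_self]
  · intro x hx
    rw [extChartAt_linB (hτc x hx)]
    refine ContinuousLinearMap.IsInvertible.comp ?_ (hP.subset_LM (hτP x hx))
    exact isInvertible_mfderiv_extChartAt (I := 𝓡 n) (x := l₀.proj) (by simpa using hτc x hx)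
  · intro x hx A
    have ht : (x, A) ∈ (extChartAt (IL n) l₀).target := (mem_extChartAt_target_linB _ _).2 hx.1
    constructor
    · intro h
      obtain ⟨a, ha, ha'⟩ := hP.exists_rightMul _ (hτP x hx) _ h
        ((hτp x hx).trans (proj_extChartAt_symm (q := (x, A)) hx.1).symm)
      refine ⟨a, ha, ?_⟩
      have h3 := rightMul_coord (hτc x hx) a
      rw [← ha', (extChartAt (IL n) l₀).right_inv ht] at h3
      exact congrArg Prod.snd h3
    · rintro ⟨a, ha, rfl⟩
      have h3 := rightMul_coord (hτc x hx) a
      rw [hτ1 x hx] at h3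
      rw [← h3, (extChartAt (IL n) l₀).left_inv
        ((mem_extChartAt_source_linB _ (rightMul a (τ x))).2 (hτc x hx))]
      exact hP.rightMul_mem _ (hτP x hx) _ ha

theorem exists_Ioo_subset {S : Set ℝ} (hS : S ∈ 𝓝 (0 : ℝ)) : ∃ ε > 0, Set.Ioo (-ε) ε ⊆ S := by
  obtain ⟨ε, hε, h⟩ := Metric.mem_nhds_iff.1 hS
  exact ⟨ε, hε, by simpa [Real.ball_eq_Ioo] using h⟩

theorem extChartAt_rightMul_self (l₀ : LinB n M) (a : GLn n) :
    extChartAt (IL n) l₀ (rightMul a l₀) =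
      (chartAt (E n) l₀.proj l₀.proj, l₀.mat.comp (a : E n →L[ℝ] E n)) := by
  rw [rightMul_coord (mem_chart_source _ _), extChartAt_self]

theorem IsChartSection.exists_of_mem_tangentVectors {G : Subgroup (GLn n)} {P : Set (LinB n M)}
    {l₀ : LinB n M} {V : Set (E n)} {s : E n → E n →L[ℝ] E n} (h : IsChartSection G P l₀ V s)
    {a : GLn n} (ha : a ∈ G) {X : E n × (E n →L[ℝ] E n)}
    (hX : X ∈ tangentVectors P (rightMul a l₀)) :
    ∃ Y ∈ lieAlg G, X.2 = (fderiv ℝ s (chartAt (E n) l₀.proj l₀.proj) X.1).comp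
      (a : E n →L[ℝ] E n) + (l₀.mat.comp (a : E n →L[ℝ] E n)).comp Y := by
  obtain ⟨hV, hyV, hVt, hs, hs0, hsi, hsP⟩ := h
  set c := chartAt (E n) l₀.proj with hc
  have hyc : l₀.proj ∈ c.source := mem_chart_source _ _
  have hs' : HasFDerivAt s (fderiv ℝ s (c l₀.proj)) (c l₀.proj) :=
    ((hs.contDiffAt (hV.mem_nhds hyV)).differentiableAt (by simp)).hasFDerivAt
  have hl := extChartAt_rightMul_self l₀ a
  obtain ⟨ε, hε, γ, hγ, hγP, hγ0, hγ'⟩ := hX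
  have h0 : (0 : ℝ) ∈ Set.Ioo (-ε) ε := by simpa using hε
  have hγc := hγ'.1
  have hZ : HasDerivAt (fun t => extChartAt (IL n) l₀ (γ t)) X 0 := by
    have := ((hasMFDerivAt_linB_iff (f' := ContinuousLinearMap.toSpanSingleton ℝ X)).1 hγ').2
    rw [hγ0, extChartAt_congr_proj (l := rightMul a l₀) (l' := l₀) rfl] at this
    simpa using this.hasDerivAt
  set Z := fun t => extChartAt (IL n) l₀ (γ t) with hZdef
  have hZ0 : Z 0 = (c l₀.proj, l₀.mat.comp (a : E n →L[ℝ] E n)) := by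
    rw [← hl, ← hγ0]
  have hsrc : ∀ᶠ t in 𝓝 (0 : ℝ), γ t ∈ (extChartAt (IL n) l₀).source := by
    refine hγc.eventually ((isOpen_extChartAt_source l₀).mem_nhds ?_)
    rw [hγ0, mem_extChartAt_source_linB]
    exact hyc
  have hZV : ∀ᶠ t in 𝓝 (0 : ℝ), (Z t).1 ∈ V := by
    refine hZ.continuousAt.fst.eventually (hV.mem_nhds ?_)
    change (Z 0).1 ∈ V
    rw [hZ0]
    exact hyV
  obtain ⟨δ, hδ, hδ'⟩ := exists_Ioo_subset
    (inter_mem (Ioo_mem_nhds h0.1 h0.2) (hsrc.and hZV))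
  have hZs : ContDiffOn ℝ ∞ Z (Set.Ioo (-δ) δ) := by
    refine contMDiffOn_iff_contDiffOn.1 ?_
    refine (contMDiffOn_extChartAt (I := IL n) (n := ∞) (x := l₀)).comp
      (hγ.mono fun t ht => (hδ' ht).1) fun t ht => ?_
    rw [← extChartAt_source (IL n)]
    exact (hδ' ht).2.1
  have hA : ∀ t ∈ Set.Ioo (-δ) δ, ∃ b ∈ G, (Z t).2 = (s (Z t).1).comp (b : E n →L[ℝ] E n) := by
    intro t ht
    refine (hsP _ (hδ' ht).2.2 _).1 ?_
    change (extChartAt (IL n) l₀).symm (Z t) ∈ P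
    rw [hZdef, (extChartAt (IL n) l₀).left_inv (hδ' ht).2.1]
    exact hγP t (hδ' ht).1
  -- In coordinates the curve is `s (x t) ∘ a ∘ g t`, with `g` a curve in `G` through the identity.
  set g : ℝ → E n →L[ℝ] E n := fun t =>
    (a.symm : E n →L[ℝ] E n).comp ((s (Z t).1).inverse.comp (Z t).2) with hg
  have h0δ : (0 : ℝ) ∈ Set.Ioo (-δ) δ := by simpa using hδ
  have hgG : ∀ t ∈ Set.Ioo (-δ) δ, ∃ b ∈ G, (b : E n →L[ℝ] E n) = g t := by
    intro t ht
    obtain ⟨b, hb, hb'⟩ := hA t ht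
    refine ⟨a⁻¹ * b, G.mul_mem (G.inv_mem ha) hb, ?_⟩
    obtain ⟨S, hS⟩ := hsi _ (hδ' ht).2.2
    rw [hg]
    dsimp only
    rw [hb', ← hS, ContinuousLinearMap.inverse_equiv]
    ext1 v
    change a.symm (b v) = a.symm (S.symm (S (b v)))
    simp
  have hgZ : ∀ t ∈ Set.Ioo (-δ) δ,
      (Z t).2 = ((s (Z t).1).comp (a : E n →L[ℝ] E n)).comp (g t) := by
    intro t ht
    obtain ⟨S, hS⟩ := hsi _ (hδ' ht).2.2
    rw [hg]
    dsimp only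
    rw [← hS, ContinuousLinearMap.inverse_equiv]
    ext1 v
    simp
  have hgs : ContDiffOn ℝ ∞ g (Set.Ioo (-δ) δ) := by
    refine contDiffOn_const.clm_comp (ContDiffOn.clm_comp (fun t ht => ?_) hZs.snd)
    refine ContDiffAt.comp_contDiffWithinAt (g := ContinuousLinearMap.inverse)
      (f := fun t => s (Z t).1) t ?_
      ((hs _ (hδ' ht).2.2).comp t (hZs.fst t ht) fun t ht => (hδ' ht).2.2)
    exact (hsi _ (hδ' ht).2.2).contDiffAt_map_inverse
  have hg0 : g 0 = ContinuousLinearMap.id ℝ (E n) := by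
    obtain ⟨S, hS⟩ := hsi _ hyV
    rw [hg]
    dsimp only
    rw [hZ0]
    dsimp only
    rw [← hs0, ← hS, ContinuousLinearMap.inverse_equiv]
    ext1 v
    change a.symm (S.symm (S (a v))) = v
    simp
  have hgd : HasDerivAt g (deriv g 0) 0 :=
    ((hgs.contDiffAt (Ioo_mem_nhds h0δ.1 h0δ.2)).differentiableAt (by simp)).hasDerivAt
  -- The velocity of `g` at `0` is the vertical part of `X`.
  refine ⟨deriv g 0, ⟨δ, hδ, g, hgs, hgG, hg0, hgd⟩, ?_⟩
  have hd1 : HasDerivAt (fun t => s (Z t).1) (fderiv ℝ s (c l₀.proj) X.1) 0 := by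
    have hx : HasDerivAt (fun t => (Z t).1) X.1 0 := by
      simpa using (hZ.hasFDerivAt.fst).hasDerivAt
    refine HasFDerivAt.comp_hasDerivAt (0 : ℝ) ?_ hx
    rw [hZ0]
    exact hs'
  have hd2 : HasDerivAt (fun t => (Z t).2) X.2 0 := by
    simpa using (hZ.hasFDerivAt.snd).hasDerivAt
  have hd3 := (hd1.clm_comp (hasDerivAt_const (0 : ℝ) (a : E n →L[ℝ] E n))).clm_comp hgd
  have hd4 := hd3.congr_of_eventuallyEq
    (Filter.eventuallyEq_of_mem (Ioo_mem_nhds h0δ.1 h0δ.2) hgZ)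
  rw [hd2.unique hd4, hg0, hZ0]
  dsimp only
  rw [hs0]
  simp

theorem IsChartSection.mem_tangentVectors {G : Subgroup (GLn n)} {P : Set (LinB n M)}
    {l₀ : LinB n M} {V : Set (E n)} {s : E n → E n →L[ℝ] E n} (h : IsChartSection G P l₀ V s)
    {a : GLn n} (ha : a ∈ G) {X : E n × (E n →L[ℝ] E n)} {Y : E n →L[ℝ] E n} (hY : Y ∈ lieAlg G)
    (hXY : X.2 = (fderiv ℝ s (chartAt (E n) l₀.proj l₀.proj) X.1).comp (a : E n →L[ℝ] E n) +
      (l₀.mat.comp (a : E n →L[ℝ] E n)).comp Y) :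
    X ∈ tangentVectors P (rightMul a l₀) := by
  obtain ⟨hV, hyV, hVt, hs, hs0, -, hsP⟩ := h
  set c := chartAt (E n) l₀.proj with hc
  have hyc : l₀.proj ∈ c.source := mem_chart_source _ _
  have hs' : HasFDerivAt s (fderiv ℝ s (c l₀.proj)) (c l₀.proj) :=
    ((hs.contDiffAt (hV.mem_nhds hyV)).differentiableAt (by simp)).hasFDerivAt
  have hl := extChartAt_rightMul_self l₀ a
  obtain ⟨ε, hε, β, hβ, hβG, hβ0, hβY⟩ := hY
  have h0 : (0 : ℝ) ∈ Set.Ioo (-ε) ε := by simpa using hε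
  have hline : Continuous fun t : ℝ => c l₀.proj + t • X.1 := by fun_prop
  obtain ⟨δ, hδ, hδ'⟩ := exists_Ioo_subset (inter_mem (Ioo_mem_nhds h0.1 h0.2)
    (hline.continuousAt.preimage_mem_nhds (hV.mem_nhds (by simpa using hyV))))
  have h0δ : (0 : ℝ) ∈ Set.Ioo (-δ) δ := by simpa using hδ
  -- The curve in `P` lies over a straight line and follows the section, moved along a curve in `G`.
  set Z : ℝ → E n × (E n →L[ℝ] E n) := fun t => (c l₀.proj + t • X.1,
    ((s (c l₀.proj + t • X.1)).comp (a : E n →L[ℝ] E n)).comp (β t)) with hZ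
  have hZs : ContDiffOn ℝ ∞ Z (Set.Ioo (-δ) δ) := by
    have hx : ContDiffOn ℝ ∞ (fun t : ℝ => c l₀.proj + t • X.1) (Set.Ioo (-δ) δ) :=
      ((contDiff_const (c := c l₀.proj)).add
        ((contDiff_id (E := ℝ)).smul (contDiff_const (c := X.1)))).contDiffOn
    exact hx.prodMk (((hs.comp hx fun t ht => (hδ' ht).2).clm_comp contDiffOn_const).clm_comp
      (hβ.mono fun t ht => (hδ' ht).1))
  have hZt : ∀ t ∈ Set.Ioo (-δ) δ, Z t ∈ (extChartAt (IL n) l₀).target := fun t ht =>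
    (mem_extChartAt_target_linB _ _).2 (hVt (hδ' ht).2)
  set γ : ℝ → LinB n M := fun t => (extChartAt (IL n) l₀).symm (Z t) with hγ
  have hγ0 : γ 0 = rightMul a l₀ := by
    change (extChartAt (IL n) l₀).symm (Z 0) = _
    have : Z 0 = extChartAt (IL n) l₀ (rightMul a l₀) := by
      rw [hl]
      have h1 : c l₀.proj + (0 : ℝ) • X.1 = c l₀.proj := by rw [zero_smul, add_zero]
      refine Prod.ext h1 ?_
      change ((s (c l₀.proj + (0 : ℝ) • X.1)).comp (a : E n →L[ℝ] E n)).comp (β 0) = _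
      rw [h1, hβ0, hs0]
      rfl
    rw [this, (extChartAt (IL n) l₀).left_inv]
    exact (mem_extChartAt_source_linB _ _).2 hyc
  have hγs : ContMDiffOn 𝓘(ℝ, ℝ) (IL n) ∞ γ (Set.Ioo (-δ) δ) :=
    (contMDiffOn_extChartAt_symm l₀).comp (contMDiffOn_iff_contDiffOn.2 hZs) hZt
  refine ⟨δ, hδ, γ, hγs, ?_, hγ0, ?_⟩
  · intro t ht
    obtain ⟨b, hb, hb'⟩ := hβG t (hδ' ht).1
    exact (hsP _ (hδ' ht).2 _).2 ⟨a * b, G.mul_mem ha hb, by rw [← hb']; rfl⟩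
  · refine (hasMFDerivAt_linB_iff (f' := ContinuousLinearMap.toSpanSingleton ℝ X)).2
      ⟨(hγs.continuousOn).continuousAt (Ioo_mem_nhds h0δ.1 h0δ.2), ?_⟩
    rw [hγ0, extChartAt_congr_proj (l := rightMul a l₀) (l' := l₀) rfl]
    have hx : HasDerivAt (fun t : ℝ => c l₀.proj + t • X.1) X.1 0 := by
      simpa using ((hasDerivAt_id (0 : ℝ)).smul_const X.1).const_add (c l₀.proj)
    have hd1 : HasDerivAt (fun t : ℝ => s (c l₀.proj + t • X.1))
        (fderiv ℝ s (c l₀.proj) X.1) 0 := by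
      refine HasFDerivAt.comp_hasDerivAt (0 : ℝ) ?_ hx
      simpa using hs'
    have hd3 := (hd1.clm_comp (hasDerivAt_const (0 : ℝ) (a : E n →L[ℝ] E n))).clm_comp hβY
    have hd4 : HasDerivAt Z X 0 := by
      have h := hx.prodMk hd3
      have e : (X.1, X.2) = X := rfl
      rw [← e, hXY]
      convert h using 2
      simp [hβ0, hs0]
    refine (hd4.congr_of_eventuallyEq ?_).hasFDerivAt
    filter_upwards [Ioo_mem_nhds h0δ.1 h0δ.2] with t ht
    exact (extChartAt (IL n) l₀).right_inv (hZt t ht)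

/-- In the preferred chart, `T P` at the points `l₀ ∘ a` of the fibre through `l₀` is an affine
family over the base directions with model space the vertical vectors `l₀ ∘ a ∘ 𝔤`. The map `D`,
the derivative of a local section through `l₀`, serves all points of the fibre. -/
theorem IsGStructure.mem_tangentVectors_iff {G : Subgroup (GLn n)} {P : Set (LinB n M)}
    (hP : IsGStructure G P) {l₀ : LinB n M} (hl₀ : l₀ ∈ P) :
    ∃ D : E n →L[ℝ] E n →L[ℝ] E n, ∀ a ∈ G, ∀ X : E n × (E n →L[ℝ] E n),
      X ∈ tangentVectors P (rightMul a l₀) ↔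
        ∃ Y ∈ lieAlg G, X.2 = (D X.1).comp (a : E n →L[ℝ] E n) +
          (l₀.mat.comp (a : E n →L[ℝ] E n)).comp Y := by
  obtain ⟨V, s, h⟩ := hP.exists_isChartSection hl₀
  exact ⟨fderiv ℝ s (chartAt (E n) l₀.proj l₀.proj), fun a ha X =>
    ⟨h.exists_of_mem_tangentVectors ha, fun ⟨Y, hY, hXY⟩ => h.mem_tangentVectors ha hY hXY⟩⟩

/-! ### Change of the chart and of the 2-frame in 2-jets -/

theorem fderiv_comp_chart_symm_symmetric {c : OpenPartialHomeomorph M (E n)}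
    (hc : c ∈ IsManifold.maximalAtlas (𝓡 n) ∞ M) (e : OChart n M) (hx : e.1.symm 0 ∈ c.source)
    (u v : E n) :
    fderiv ℝ (fderiv ℝ (c ∘ e.1.symm)) 0 u v = fderiv ℝ (fderiv ℝ (c ∘ e.1.symm)) 0 v u :=
  ((contDiffAt_chart_comp e hc hx).isSymmSndFDerivAt
    (by simpa using ENat.LEInfty.out)).eq u v

theorem fderiv_chart_comp_act {c : OpenPartialHomeomorph M (E n)}
    (hc : c ∈ IsManifold.maximalAtlas (𝓡 n) ∞ M) (e : OChart n M) (hx : e.1.symm 0 ∈ c.source)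
    (g : G2 n) :
    fderiv ℝ (c ∘ (e.act g).1.symm) 0 =
      (fderiv ℝ (c ∘ e.1.symm) 0).comp (g.lin : E n →L[ℝ] E n) := by
  have hF : ContDiffAt ℝ ∞ (c ∘ e.1.symm) (g.poly 0) := by
    rw [g.poly_zero]; exact contDiffAt_chart_comp e hc hx
  rw [OChart.act_symm, ← Function.comp_assoc, fderiv_comp (0 : E n) (hF.differentiableAt (by simp))
    (g.contDiff_poly.differentiable (by simp) 0), g.hasFDerivAt_poly.fderiv, g.poly_zero]

theorem fderiv_fderiv_chart_comp_act {c : OpenPartialHomeomorph M (E n)}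
    (hc : c ∈ IsManifold.maximalAtlas (𝓡 n) ∞ M) (e : OChart n M) (hx : e.1.symm 0 ∈ c.source)
    (g : G2 n) (u v : E n) :
    fderiv ℝ (fderiv ℝ (c ∘ (e.act g).1.symm)) 0 u v =
      fderiv ℝ (fderiv ℝ (c ∘ e.1.symm)) 0 (g.lin u) (g.lin v) +
        fderiv ℝ (c ∘ e.1.symm) 0 (g.lin (g.quad.1 u v)) := by
  have hF : ContDiffAt ℝ ∞ (c ∘ e.1.symm) (g.poly 0) := by
    rw [g.poly_zero]; exact contDiffAt_chart_comp e hc hx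
  rw [OChart.act_symm, ← Function.comp_assoc,
    fderiv_fderiv_comp hF g.contDiff_poly.contDiffAt, g.hasFDerivAt_poly.fderiv,
    g.fderiv_fderiv_poly, g.poly_zero]
  rfl

theorem contDiffAt_transition {c c' : OpenPartialHomeomorph M (E n)}
    (hc : c ∈ IsManifold.maximalAtlas (𝓡 n) ∞ M) (hc' : c' ∈ IsManifold.maximalAtlas (𝓡 n) ∞ M)
    {y : M} (hy : y ∈ c.source) (hy' : y ∈ c'.source) :
    ContDiffAt ℝ ∞ (c' ∘ c.symm) (c y) := by
  refine contMDiffAt_iff_contDiffAt.1 (ContMDiffAt.comp (I' := 𝓡 n) (c y) ?_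
    (contMDiffAt_symm_of_mem_maximalAtlas hc (c.map_source hy)))
  rw [c.left_inv hy]
  exact contMDiffAt_of_mem_maximalAtlas hc' hy'

theorem chart_comp_eventuallyEq {c c' : OpenPartialHomeomorph M (E n)} (e : OChart n M)
    (hx : e.1.symm 0 ∈ c.source) :
    c' ∘ e.1.symm =ᶠ[𝓝 0] (c' ∘ c.symm) ∘ (c ∘ e.1.symm) := by
  filter_upwards [(e.1.continuousAt_symm e.2.2).eventually (c.open_source.mem_nhds hx)] with ξ hξ
  simp [c.left_inv hξ]

theorem fderiv_chart_change {c c' : OpenPartialHomeomorph M (E n)}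
    (hc : c ∈ IsManifold.maximalAtlas (𝓡 n) ∞ M) (hc' : c' ∈ IsManifold.maximalAtlas (𝓡 n) ∞ M)
    (e : OChart n M) (hx : e.1.symm 0 ∈ c.source)
    (hx' : e.1.symm 0 ∈ c'.source) :
    fderiv ℝ (c' ∘ e.1.symm) 0 = (fderiv ℝ (c' ∘ c.symm) (c (e.1.symm 0))).comp
      (fderiv ℝ (c ∘ e.1.symm) 0) := by
  rw [(chart_comp_eventuallyEq e hx).fderiv_eq]
  exact fderiv_comp (0 : E n)
    ((contDiffAt_transition hc hc' hx hx').differentiableAt (by simp))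
    ((contDiffAt_chart_comp e hc hx).differentiableAt (by simp))

theorem fderiv_fderiv_chart_change {c c' : OpenPartialHomeomorph M (E n)}
    (hc : c ∈ IsManifold.maximalAtlas (𝓡 n) ∞ M) (hc' : c' ∈ IsManifold.maximalAtlas (𝓡 n) ∞ M)
    (e : OChart n M) (hx : e.1.symm 0 ∈ c.source)
    (hx' : e.1.symm 0 ∈ c'.source) (u v : E n) :
    fderiv ℝ (fderiv ℝ (c' ∘ e.1.symm)) 0 u v =
      fderiv ℝ (fderiv ℝ (c' ∘ c.symm)) (c (e.1.symm 0)) (fderiv ℝ (c ∘ e.1.symm) 0 u)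
        (fderiv ℝ (c ∘ e.1.symm) 0 v) +
      fderiv ℝ (c' ∘ c.symm) (c (e.1.symm 0)) (fderiv ℝ (fderiv ℝ (c ∘ e.1.symm)) 0 u v) := by
  rw [(chart_comp_eventuallyEq e hx).fderiv.fderiv_eq]
  exact fderiv_fderiv_comp (g := c ∘ e.1.symm) (contDiffAt_transition hc hc' hx hx')
    (contDiffAt_chart_comp e hc hx) u v

/-- Equality of 2-jets can be tested in a single chart. -/
theorem sameJet_of_chart {c : OpenPartialHomeomorph M (E n)}
    (hc : c ∈ IsManifold.maximalAtlas (𝓡 n) ∞ M) {e e' : OChart n M}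
    (h : e.1.symm 0 = e'.1.symm 0) (hx : e.1.symm 0 ∈ c.source)
    (h1 : fderiv ℝ (c ∘ e.1.symm) 0 = fderiv ℝ (c ∘ e'.1.symm) 0)
    (h2 : ∀ u v, fderiv ℝ (fderiv ℝ (c ∘ e.1.symm)) 0 u v =
      fderiv ℝ (fderiv ℝ (c ∘ e'.1.symm)) 0 u v) : SameJet e e' := by
  refine ⟨h, fun c' hc' hx' => ⟨?_, ?_⟩⟩
  · rw [fderiv_chart_change hc hc' e hx hx',
      fderiv_chart_change hc hc' e' (h ▸ hx) (h ▸ hx'), h1, h]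
  · ext1 u
    ext1 v
    rw [fderiv_fderiv_chart_change hc hc' e hx hx',
      fderiv_fderiv_chart_change hc hc' e' (h ▸ hx) (h ▸ hx'), h1, h2, h]

/-! ### Charts adapted to a `G`-structure -/

theorem extChartAt_frameField_zero {l₀ : LinB n M} (e : OChart n M)
    (h : e.1.symm 0 ∈ (chartAt (E n) l₀.proj).source) :
    extChartAt (IL n) l₀ (frameField e 0) = (chartAt (E n) l₀.proj (e.1.symm 0),
      fderiv ℝ (chartAt (E n) l₀.proj ∘ e.1.symm) 0) :=
  (extChartAt_frameField e h).self_of_nhds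

theorem mat_frameField (e : OChart n M) :
    (frameField e 0).mat = fderiv ℝ (chartAt (E n) (e.1.symm 0) ∘ e.1.symm) 0 := by
  have h := extChartAt_frameField_zero (l₀ := frameField e 0) e (mem_chart_source _ _)
  rw [extChartAt_self] at h
  exact congrArg Prod.snd h

theorem act_symm_zero (e : OChart n M) (g : G2 n) : (e.act g).1.symm 0 = e.1.symm 0 := by
  rw [OChart.act_symm, Function.comp_apply, g.poly_zero]

theorem frameField_act (e : OChart n M) (g : G2 n) :
    frameField (e.act g) 0 = rightMul g.lin (frameField e 0) := by
  have hx : e.1.symm 0 ∈ (chartAt (E n) (e.1.symm 0)).source := mem_chart_source _ _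
  have hx' : (e.act g).1.symm 0 ∈ (chartAt (E n) (e.1.symm 0)).source := by
    rw [act_symm_zero]; exact hx
  refine linB_ext (l₀ := frameField e 0) hx' hx ?_
  rw [rightMul_coord (l₀ := frameField e 0) (l := frameField e 0) hx,
    extChartAt_frameField_zero (l₀ := frameField e 0) e hx,
    extChartAt_frameField_zero (l₀ := frameField e 0) (e.act g) hx']
  refine Prod.ext (by rw [act_symm_zero]) ?_
  exact fderiv_chart_comp_act (IsManifold.chart_mem_maximalAtlas _) e hx g

theorem mem_tangentVectors_congr {P : Set (LinB n M)} {l l' : LinB n M} (h : l = l')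
    (X : E n × (E n →L[ℝ] E n)) : X ∈ tangentVectors P l ↔ X ∈ tangentVectors P l' := by
  subst h
  rfl

/-- The chart `e` is adapted to `P` if its 2-frame belongs to `P²`: its frame at `0` lies in `P`
and the corresponding subspace lies in `T P`. -/
def IsAdapted (P : Set (LinB n M)) (e : OChart n M) : Prop :=
  frameField e 0 ∈ P ∧ ∀ X ∈ chartSubspace e, X ∈ tangentVectors P (frameField e 0)

/-- A chart with frame `l₀ ∘ a` at `0` is adapted exactly if its second derivatives, corrected by
the derivative `D` of a local section, lie in `l₀ ∘ a ∘ 𝔤` in every direction. -/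
theorem IsGStructure.exists_isAdapted_iff {G : Subgroup (GLn n)} {P : Set (LinB n M)}
    (hP : IsGStructure G P) {l₀ : LinB n M} (hl₀ : l₀ ∈ P) :
    ∃ D : E n →L[ℝ] E n →L[ℝ] E n, ∀ a ∈ G, ∀ e : OChart n M, frameField e 0 = rightMul a l₀ →
      (IsAdapted P e ↔ ∀ u, ∃ Y ∈ lieAlg G,
        fderiv ℝ (fderiv ℝ (chartAt (E n) l₀.proj ∘ e.1.symm)) 0 u =
          (D (l₀.mat (a u))).comp (a : E n →L[ℝ] E n) +
            (l₀.mat.comp (a : E n →L[ℝ] E n)).comp Y) := by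
  obtain ⟨D, hD⟩ := hP.mem_tangentVectors_iff hl₀
  refine ⟨D, fun a ha e he => ?_⟩
  have hy : e.1.symm 0 = l₀.proj := congrArg TotalSpace.proj he
  have hF : fderiv ℝ (chartAt (E n) l₀.proj ∘ e.1.symm) 0 =
      l₀.mat.comp (a : E n →L[ℝ] E n) := by
    have h1 := extChartAt_frameField_zero (l₀ := l₀) e (hy ▸ mem_chart_source _ _)
    rw [he, rightMul_coord (mem_chart_source _ _), extChartAt_self] at h1
    exact (congrArg Prod.snd h1).symm
  have h0 : frameField e 0 ∈ P := he ▸ hP.rightMul_mem _ hl₀ _ ha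
  have h1 : IsAdapted P e ↔ ∀ u, mfderiv 𝓘(ℝ, E n) (IL n) (frameField e) 0 u ∈
      tangentVectors P (frameField e 0) :=
    ⟨fun h u => h.2 _ ⟨u, rfl⟩, fun h => ⟨h0, by rintro _ ⟨u, rfl⟩; exact h u⟩⟩
  rw [h1]
  refine forall_congr' fun u => ?_
  refine (iff_of_eq (congrArg (· ∈ tangentVectors P (frameField e 0))
    (mfderiv_frameField_self e u))).trans ((mem_tangentVectors_congr he _).trans
      ((hD a ha _).trans ?_))
  rw [hy, hF]
  rfl

theorem IsAdapted.act {G : Subgroup (GLn n)} {P : Set (LinB n M)} (hP : IsGStructure G P)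
    {e : OChart n M} (he : IsAdapted P e) {g : G2 n} (hg : g ∈ prolongedGroup G) :
    IsAdapted P (e.act g) := by
  obtain ⟨D, hD⟩ := hP.exists_isAdapted_iff he.1
  have h1 := (hD 1 G.one_mem e rfl).1 he
  refine (hD g.lin hg.1 (e.act g) (frameField_act e g)).2 fun u => ?_
  obtain ⟨Y, hY, hY'⟩ := h1 (g.lin u)
  refine ⟨_, add_mem (lieAlg_conj hY hg.1) (hg.2 u), ?_⟩
  ext1 v
  refine (fderiv_fderiv_chart_comp_act (IsManifold.chart_mem_maximalAtlas _) e
    (mem_chart_source _ _) g u v).trans ?_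
  have h2 := DFunLike.congr_fun hY' (g.lin v)
  refine (congrArg₂ (· + ·) h2 rfl).trans ?_
  have h3 := mat_frameField e
  change (D ((frameField e 0).mat (g.lin u)) (g.lin v) + (frameField e 0).mat (Y (g.lin v))) +
    fderiv ℝ (chartAt (E n) (e.1.symm 0) ∘ e.1.symm) 0 (g.lin (g.quad.1 u v)) =
    D ((frameField e 0).mat (g.lin u)) (g.lin v) +
    (frameField e 0).mat (g.lin (g.lin.symm (Y (g.lin v)) + g.quad.1 u v))
  rw [← h3]
  simp [add_assoc]

/-- Two adapted charts at the same point differ by an element `(a, T)` of `G ⋊ 𝔤₁`: `a` compares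
the frames and `T` the second derivatives, in which the correction by `D` cancels. -/
theorem IsAdapted.exists_act {G : Subgroup (GLn n)} {P : Set (LinB n M)} (hP : IsGStructure G P)
    {e e' : OChart n M} (he : IsAdapted P e) (he' : IsAdapted P e')
    (h : e.1.symm 0 = e'.1.symm 0) : ∃ g ∈ prolongedGroup G, SameJet e' (e.act g) := by
  obtain ⟨a, ha, haa⟩ := hP.exists_rightMul _ he.1 _ he'.1 h
  obtain ⟨D, hD⟩ := hP.exists_isAdapted_iff he.1
  have h1 := (hD 1 G.one_mem e rfl).1 he
  have h2 := (hD a ha e' haa).1 he'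
  set c := chartAt (E n) (e.1.symm 0) with hc
  have hcm : c ∈ IsManifold.maximalAtlas (𝓡 n) ∞ M := IsManifold.chart_mem_maximalAtlas _
  have hx : e.1.symm 0 ∈ c.source := mem_chart_source _ _
  have hx' : e'.1.symm 0 ∈ c.source := h ▸ hx
  change ∀ u, ∃ Y ∈ lieAlg G, fderiv ℝ (fderiv ℝ (c ∘ e.1.symm)) 0 u = _ at h1
  change ∀ u, ∃ Y ∈ lieAlg G, fderiv ℝ (fderiv ℝ (c ∘ e'.1.symm)) 0 u = _ at h2
  obtain ⟨S, hS⟩ : ((frameField e 0).mat).IsInvertible := hP.subset_LM he.1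
  rw [← hS] at h1 h2
  set Q := fderiv ℝ (fderiv ℝ (c ∘ e.1.symm)) 0 with hQ
  set Q' := fderiv ℝ (fderiv ℝ (c ∘ e'.1.symm)) 0 with hQ'
  let T : E n →L[ℝ] E n →L[ℝ] E n :=
    (ContinuousLinearMap.compL ℝ (E n) (E n) (E n)
      ((a.symm : E n →L[ℝ] E n).comp (S.symm : E n →L[ℝ] E n))).comp
      (Q' - ((ContinuousLinearMap.compL ℝ (E n) (E n) (E n)).flip (a : E n →L[ℝ] E n)).comp
        (Q.comp (a : E n →L[ℝ] E n)))
  have hT : ∀ u v, T u v = a.symm (S.symm (Q' u v - Q (a u) (a v))) := fun u v => rfl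
  have hTs : ∀ u v, T u v = T v u := fun u v => by
    rw [hT, hT, fderiv_comp_chart_symm_symmetric hcm e' hx' u v,
      fderiv_comp_chart_symm_symmetric hcm e hx (a u) (a v)]
  -- The terms with `D` cancel, and `T u` becomes a difference of elements of `𝔤`.
  have hTg : ∀ u, T u ∈ lieAlg G := by
    intro u
    obtain ⟨Y, hY, hY'⟩ := h1 (a u)
    obtain ⟨Z, hZ, hZ'⟩ := h2 u
    have : T u = Z - ((a.symm : E n →L[ℝ] E n).comp Y).comp (a : E n →L[ℝ] E n) := by
      ext1 v
      rw [hT, hY', hZ']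
      change a.symm (S.symm (D (S (a u)) (a v) + S (a (Z v)) - (D (S (a u)) (a v) + S (Y (a v)))))
        = Z v - a.symm (Y (a v))
      simp
    rw [this]
    exact sub_mem hZ (lieAlg_conj hY ha)
  refine ⟨⟨a, ⟨T, hTs⟩⟩, ⟨ha, hTg⟩, ?_⟩
  refine sameJet_of_chart hcm ((act_symm_zero e _).trans h).symm hx' ?_ fun u v => ?_
  · rw [fderiv_chart_comp_act hcm e hx]
    have h3 := extChartAt_frameField_zero (l₀ := frameField e 0) e' hx'
    rw [haa, rightMul_coord (l₀ := frameField e 0) (l := frameField e 0) hx,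
      extChartAt_frameField_zero (l₀ := frameField e 0) e hx] at h3
    exact (congrArg Prod.snd h3).symm
  · rw [fderiv_fderiv_chart_comp_act hcm e hx]
    have h4 : fderiv ℝ (c ∘ e.1.symm) 0 = S := by rw [hS]; exact (mat_frameField e).symm
    rw [h4]
    change Q' u v = Q (a u) (a v) + S (a (T u v))
    rw [hT]
    simp

/-! ### The canonical form and torsion in coordinates -/

theorem dproj_mfderiv_extChartAt_symm {l₀ : LinB n M} {q : E n × (E n →L[ℝ] E n)}
    (hq : q.1 ∈ (chartAt (E n) l₀.proj).target) (X : E n × (E n →L[ℝ] E n)) :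
    dproj ((extChartAt (IL n) l₀).symm q)
      (mfderiv 𝓘(ℝ, E n × (E n →L[ℝ] E n)) (IL n) (extChartAt (IL n) l₀).symm q X) =
      mfderiv 𝓘(ℝ, E n) (𝓡 n) (chartAt (E n) l₀.proj).symm q.1 X.1 := by
  have ht : q ∈ (extChartAt (IL n) l₀).target := (mem_extChartAt_target_linB _ _).2 hq
  have h1 : MDifferentiableAt 𝓘(ℝ, E n × (E n →L[ℝ] E n)) (IL n) (extChartAt (IL n) l₀).symm q :=
    ((contMDiffOn_extChartAt_symm (n := ∞) l₀).contMDiffAt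
      ((isOpen_extChartAt_target l₀).mem_nhds ht)).mdifferentiableAt (by simp)
  have h2 : MDifferentiableAt (IL n) (𝓡 n) (TotalSpace.proj : LinB n M → M)
      ((extChartAt (IL n) l₀).symm q) :=
    (contMDiffAt_proj (n := ∞) _).mdifferentiableAt (by simp)
  have h3 : MDifferentiableAt 𝓘(ℝ, E n) (𝓡 n) (chartAt (E n) l₀.proj).symm q.1 :=
    (contMDiffAt_symm_of_mem_maximalAtlas (n := ∞) (I := 𝓡 n)
      (IsManifold.chart_mem_maximalAtlas l₀.proj) hq).mdifferentiableAt (by simp)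
  have h4 : (TotalSpace.proj : LinB n M → M) ∘ (extChartAt (IL n) l₀).symm =ᶠ[𝓝 q]
      (chartAt (E n) l₀.proj).symm ∘ Prod.fst := by
    filter_upwards [(isOpen_extChartAt_target l₀).mem_nhds ht] with p hp
    exact proj_extChartAt_symm ((mem_extChartAt_target_linB _ _).1 hp)
  have h5 := mfderiv_comp q h2 h1
  have h6 := mfderiv_comp (I := 𝓘(ℝ, E n × (E n →L[ℝ] E n))) (f := Prod.fst) q h3
    (differentiableAt_fst.mdifferentiableAt)
  rw [h4.mfderiv_eq, h6, mfderiv_eq_fderiv, fderiv_fst] at h5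
  exact (DFunLike.congr_fun h5 X).symm

theorem dproj_eq (l : LinB n M) (X : E n × (E n →L[ℝ] E n)) :
    dproj l X = X.1 := by
  have h := dproj_mfderiv_extChartAt_symm (l₀ := l) (q := extChartAt (IL n) l l)
    (by rw [extChartAt_self]; exact mem_chart_target _ _) X
  have h1 := mfderivWithin_range_extChartAt_symm (I := IL n) (x := l)
  have h2 := mfderivWithin_range_extChartAt_symm (I := 𝓡 n) (x := l.proj)
  rw [ModelWithCorners.range_eq_univ, mfderivWithin_univ] at h1 h2
  rw [h1, (extChartAt (IL n) l).left_inv (mem_extChartAt_source l)] at h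
  refine h.trans ?_
  rw [extChartAt_self]
  exact DFunLike.congr_fun h2 X.1

/-- In coordinates `(x, A)` the canonical form is `(v, B) ↦ A⁻¹ v`. -/
theorem thetaChart_apply {l₀ : LinB n M} {q : E n × (E n →L[ℝ] E n)}
    (hq : q.1 ∈ (chartAt (E n) l₀.proj).target) (hq2 : q.2.IsInvertible) :
    thetaChart l₀ q = q.2.inverse.comp (ContinuousLinearMap.fst ℝ (E n) (E n →L[ℝ] E n)) := by
  refine ContinuousLinearMap.ext fun X => ?_
  change (LinB.map ((extChartAt (IL n) l₀).symm q)).inverse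
    (dproj ((extChartAt (IL n) l₀).symm q)
      (mfderiv 𝓘(ℝ, E n × (E n →L[ℝ] E n)) (IL n) (extChartAt (IL n) l₀).symm q X)) =
      q.2.inverse X.1
  rw [dproj_mfderiv_extChartAt_symm hq]
  set c := chartAt (E n) l₀.proj with hc
  have ht : q ∈ (extChartAt (IL n) l₀).target := (mem_extChartAt_target_linB _ _).2 hq
  have hs := (mem_extChartAt_source_linB _ _).1 ((extChartAt (IL n) l₀).map_target ht)
  have h1 := extChartAt_linB hs
  rw [(extChartAt (IL n) l₀).right_inv ht] at h1
  set l := (extChartAt (IL n) l₀).symm q with hl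
  have h2 : q.2 = (mfderiv (𝓡 n) 𝓘(ℝ, E n) c l.proj).comp l.map := congrArg Prod.snd h1
  have h3 : q.1 = c l.proj := congrArg Prod.fst h1
  have hcm : c.MDifferentiable (𝓡 n) 𝓘(ℝ, E n) := mdifferentiable_chart _
  have h4 := hcm.symm_comp_deriv hs
  rw [← h3] at h4
  obtain ⟨K, hK⟩ : (mfderiv (𝓡 n) 𝓘(ℝ, E n) c l.proj).IsInvertible :=
    isInvertible_mfderiv_extChartAt (I := 𝓡 n) (x := l₀.proj) (by simpa using hs)
  obtain ⟨R, hR⟩ := hq2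
  have h5 : ∀ w, mfderiv 𝓘(ℝ, E n) (𝓡 n) c.symm q.1 (q.2 w) = l.map w := fun w => by
    rw [h2]
    exact DFunLike.congr_fun h4 (l.map w)
  have h6 : l.map = ((R.trans K.symm : E n ≃L[ℝ] TangentSpace (𝓡 n) l.proj) :
      E n →L[ℝ] TangentSpace (𝓡 n) l.proj) := by
    ext1 w
    have h7 : q.2 w = K (l.map w) := by rw [h2, ← hK]; rfl
    change l.map w = K.symm (R w)
    rw [← K.symm_apply_apply (l.map w), ← h7, ← hR]
    rfl
  have h8 : mfderiv 𝓘(ℝ, E n) (𝓡 n) c.symm q.1 X.1 = l.map (R.symm X.1) := by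
    rw [← h5, ← hR]
    simp
  rw [← hR, ContinuousLinearMap.inverse_equiv]
  refine (congrArg _ h8).trans ?_
  rw [h6, ContinuousLinearMap.inverse_equiv]
  exact (R.trans K.symm).symm_apply_apply _

/-- `dθ((v, B), (w, C)) = A⁻¹ C A⁻¹ v - A⁻¹ B A⁻¹ w` at a frame with matrix `A`. -/
theorem dtheta_eq {l : LinB n M} (S : E n ≃L[ℝ] E n) (hS : (S : E n →L[ℝ] E n) = l.mat)
    (X Y : E n × (E n →L[ℝ] E n)) :
    dtheta l X Y = S.symm (Y.2 (S.symm X.1)) - S.symm (X.2 (S.symm Y.1)) := by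
  have h1 : thetaChart l =ᶠ[𝓝 (extChartAt (IL n) l l)] fun q =>
      q.2.inverse.comp (ContinuousLinearMap.fst ℝ (E n) (E n →L[ℝ] E n)) := by
    rw [extChartAt_self]
    have hs : ∀ᶠ q in 𝓝 ((chartAt (E n) l.proj l.proj, l.mat) : E n × (E n →L[ℝ] E n)),
        q.2.IsInvertible :=
      continuousAt_snd.eventually ((ContinuousLinearEquiv.isOpen (𝕜 := ℝ)).mem_nhds ⟨S, hS⟩)
    filter_upwards [hs, continuousAt_fst.eventually ((chartAt (E n) l.proj).open_target.mem_nhds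
      (mem_chart_target (E n) l.proj))] with q h2 h3
    exact thetaChart_apply h3 h2
  set q₀ : E n × (E n →L[ℝ] E n) := extChartAt (IL n) l l with hq₀
  have hq : q₀.2 = S := by rw [hq₀, extChartAt_self, hS]
  obtain ⟨J, hJ⟩ : ∃ J, HasFDerivAt (fun q : E n × (E n →L[ℝ] E n) => q.2.inverse) J q₀ := by
    have h : ContDiffAt ℝ 1 ContinuousLinearMap.inverse q₀.2 := by
      rw [hq]
      exact contDiffAt_map_inverse S
    exact ⟨_, ((h.differentiableAt (by simp)).comp q₀ differentiableAt_snd).hasFDerivAt⟩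
  -- The derivative of the inversion, from the product rule for `A⁻¹ A = 1`.
  have hJ' : ∀ Z : E n × (E n →L[ℝ] E n), ∀ w, J Z w = - S.symm (Z.2 (S.symm w)) := by
    intro Z w
    have h2 : (fun q : E n × (E n →L[ℝ] E n) => q.2.inverse.comp q.2) =ᶠ[𝓝 q₀]
        fun _ => ContinuousLinearMap.id ℝ (E n) := by
      have hs : ∀ᶠ q : E n × (E n →L[ℝ] E n) in 𝓝 q₀, q.2.IsInvertible :=
        continuousAt_snd.eventually
          ((ContinuousLinearEquiv.isOpen (𝕜 := ℝ)).mem_nhds ⟨S, hq.symm⟩)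
      filter_upwards [hs] with q hq
      exact hq.inverse_comp_self
    have h3 := (hJ.clm_comp (hasFDerivAt_snd (𝕜 := ℝ) (p := q₀))).congr_of_eventuallyEq h2.symm
    have h4 := DFunLike.congr_fun (DFunLike.congr_fun
      (h3.unique (hasFDerivAt_const (ContinuousLinearMap.id ℝ (E n)) q₀)) Z) (S.symm w)
    rw [hq, ContinuousLinearMap.inverse_equiv] at h4
    have h5 : S.symm (Z.2 (S.symm w)) + J Z (S (S.symm w)) = 0 := h4
    rw [S.apply_symm_apply] at h5
    exact eq_neg_of_add_eq_zero_right h5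
  have h6 : ∀ Z W : E n × (E n →L[ℝ] E n), fderiv ℝ (thetaChart l) q₀ Z W = J Z W.1 := by
    intro Z W
    rw [h1.fderiv_eq, (hJ.clm_comp (hasFDerivAt_const
      (ContinuousLinearMap.fst ℝ (E n) (E n →L[ℝ] E n)) q₀)).fderiv]
    simp
  unfold dtheta
  rw [mfderiv_extChartAt_self]
  change fderiv ℝ (thetaChart l) q₀ X Y - fderiv ℝ (thetaChart l) q₀ Y X = _
  rw [h6, h6, hJ', hJ']
  abel

/-! ### Charts with a given 2-jet -/

theorem addRight_neg_symm_apply (a x : E n) : (Homeomorph.addRight (-a)).symm x = x + a := by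
  change x + - -a = x + a
  rw [neg_neg]

/-- The preferred chart at `y`, translated so that it sends `y` to `0`. -/
def centeredChart (y : M) : OChart n M :=
  ⟨(chartAt (E n) y).transHomeomorph (Homeomorph.addRight (-(chartAt (E n) y y))), by
    constructor
    · have he := (IsManifold.mem_maximalAtlas_iff_contMDiffOn (I := 𝓡 n) (n := ∞)
        (chartAt (E n) y)).1 (IsManifold.chart_mem_maximalAtlas y)
      rw [IsManifold.mem_maximalAtlas_iff_contMDiffOn]
      constructor
      · exact (contMDiff_iff_contDiff.2 (contDiff_id.add
          (contDiff_const (c := -(chartAt (E n) y y))))).comp_contMDiffOn he.1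
      · exact he.2.comp (contMDiff_iff_contDiff.2 (contDiff_id.add
          (contDiff_const (c := - -(chartAt (E n) y y))))).contMDiffOn fun x hx => hx
    · simp [addRight_neg_symm_apply]⟩

theorem centeredChart_symm_zero (y : M) : (centeredChart (n := n) y).1.symm 0 = y := by
  simp [centeredChart, addRight_neg_symm_apply]

theorem chartAt_comp_centeredChart_symm (y : M) :
    chartAt (E n) y ∘ (centeredChart (n := n) y).1.symm =ᶠ[𝓝 0]
      fun ξ => ξ + chartAt (E n) y y := by
  filter_upwards [(centeredChart (n := n) y).1.open_target.mem_nhds (centeredChart y).2.2] with ξ hξ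
  have h : ξ + chartAt (E n) y y ∈ (chartAt (E n) y).target := by
    simpa [centeredChart, addRight_neg_symm_apply] using hξ
  simpa [centeredChart, addRight_neg_symm_apply] using (chartAt (E n) y).right_inv h

theorem exists_chart_jet (y : M) (a : GLn n) (s : S2 n) : ∃ e : OChart n M, e.1.symm 0 = y ∧
    fderiv ℝ (chartAt (E n) y ∘ e.1.symm) 0 = a ∧
    ∀ u v, fderiv ℝ (fderiv ℝ (chartAt (E n) y ∘ e.1.symm)) 0 u v = a (s.1 u v) := by
  have h1 : fderiv ℝ (chartAt (E n) y ∘ (centeredChart (n := n) y).1.symm) =ᶠ[𝓝 0]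
      fun _ => ContinuousLinearMap.id ℝ (E n) := by
    refine (chartAt_comp_centeredChart_symm y).fderiv.trans (Eventually.of_forall fun ξ => ?_)
    simp
  have hx : (centeredChart (n := n) y).1.symm 0 ∈ (chartAt (E n) y).source := by
    rw [centeredChart_symm_zero]
    exact mem_chart_source _ _
  refine ⟨(centeredChart y).act ⟨a, s⟩, (act_symm_zero _ _).trans (centeredChart_symm_zero y),
    ?_, fun u v => ?_⟩
  · rw [fderiv_chart_comp_act (IsManifold.chart_mem_maximalAtlas y) _ hx, h1.self_of_nhds]
    rfl
  · rw [fderiv_fderiv_chart_comp_act (IsManifold.chart_mem_maximalAtlas y) _ hx, h1.self_of_nhds,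
      h1.fderiv_eq]
    simp

theorem exists_linearMap_of_isCompl_ker_fst {V W : Type*} [AddCommGroup V] [Module ℝ V]
    [AddCommGroup W] [Module ℝ W] {H : Submodule ℝ (V × W)}
    (h : IsCompl H (LinearMap.ker (LinearMap.fst ℝ V W))) :
    ∃ Γ : V →ₗ[ℝ] W, ∀ X, X ∈ H ↔ Γ X.1 = X.2 := by
  have hb : Function.Bijective (Prod.fst ∘ H.subtype) := by
    constructor
    · rintro ⟨x, hx⟩ ⟨y, hy⟩ hxy
      have h1 : x - y ∈ H ⊓ LinearMap.ker (LinearMap.fst ℝ V W) :=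
        ⟨sub_mem hx hy, by simpa [sub_eq_zero] using hxy⟩
      rw [h.inf_eq_bot, Submodule.mem_bot, sub_eq_zero] at h1
      exact Subtype.ext h1
    · intro v
      obtain ⟨x, hx, y, hy, hxy⟩ := Submodule.mem_sup.1
        (h.sup_eq_top ▸ Submodule.mem_top : (v, (0 : W)) ∈ H ⊔ LinearMap.ker (LinearMap.fst ℝ V W))
      refine ⟨⟨x, hx⟩, ?_⟩
      have h2 := congrArg Prod.fst hxy
      have h3 : y.1 = 0 := hy
      simpa [h3] using h2
  obtain ⟨Γ, hΓ⟩ := Submodule.exists_eq_graph hb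
  exact ⟨Γ, fun X => by rw [hΓ, LinearMap.mem_graph_iff, eq_comm]⟩

/-- Every torsion-free transversal subspace of `T_l LM` corresponds to a 2-frame: such a subspace is
the graph of a linear `Γ`, and torsion-freeness is the symmetry of `(u, v) ↦ l⁻¹ Γ(l u) v`, which is
therefore the second order part of the 2-jet of the inverse of a chart. -/
theorem exists_chart_of_isTorsionFree {l : LinB n M} (hl : l ∈ LM n M)
    (H : Submodule ℝ (TangentSpace (IL n) l)) (ht : IsTransversal l H) (htf : IsTorsionFree l H) :
    ∃ e : OChart n M, frameField e 0 = l ∧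
      ∀ X : E n × (E n →L[ℝ] E n), X ∈ chartSubspace e ↔ X ∈ H := by
  have hker : (LinearMap.ker (dproj l).toLinearMap : Submodule ℝ (TangentSpace (IL n) l)) =
      (LinearMap.ker (LinearMap.fst ℝ (E n) (E n →L[ℝ] E n)) :
        Submodule ℝ (E n × (E n →L[ℝ] E n))) := by
    refine SetLike.ext fun X => ?_
    exact iff_of_eq (congrArg (· = (0 : E n)) (dproj_eq l X))
  obtain ⟨Γ, hΓ⟩ : ∃ Γ : E n →ₗ[ℝ] (E n →L[ℝ] E n), ∀ X : E n × (E n →L[ℝ] E n),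
      X ∈ H ↔ Γ X.1 = X.2 := by
    unfold IsTransversal at ht
    rw [hker] at ht
    exact exists_linearMap_of_isCompl_ker_fst ht
  obtain ⟨S, hS⟩ : l.mat.IsInvertible := hl
  let T : E n →L[ℝ] E n →L[ℝ] E n :=
    (ContinuousLinearMap.compL ℝ (E n) (E n) (E n) (S.symm : E n →L[ℝ] E n)).comp
      ((LinearMap.toContinuousLinearMap Γ).comp (S : E n →L[ℝ] E n))
  have hT : ∀ u v, T u v = S.symm (Γ (S u) v) := fun u v => rfl
  have hTs : ∀ u v, T u v = T v u := by
    intro u v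
    have h1 := htf ((S u, Γ (S u)) : E n × (E n →L[ℝ] E n)) ((hΓ _).2 rfl)
      ((S v, Γ (S v)) : E n × (E n →L[ℝ] E n)) ((hΓ _).2 rfl)
    rw [dtheta_eq S hS] at h1
    have h2 : T v u - T u v = 0 := by simpa [hT] using h1
    exact (sub_eq_zero.1 h2).symm
  obtain ⟨e, he, he1, he2⟩ := exists_chart_jet l.proj S ⟨T, hTs⟩
  have hx : e.1.symm 0 ∈ (chartAt (E n) l.proj).source := he ▸ mem_chart_source _ _
  have hel : frameField e 0 = l := by
    refine linB_ext (l₀ := l) hx (mem_chart_source _ _) ?_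
    rw [extChartAt_frameField_zero e hx, extChartAt_self, he, he1, hS]
  refine ⟨e, hel, fun X => ?_⟩
  rw [hΓ]
  have h3 : ∀ u : E n, mfderiv 𝓘(ℝ, E n) (IL n) (frameField e) 0 u = (S u, Γ (S u)) := by
    intro u
    refine (mfderiv_frameField_self e u).trans ?_
    rw [he, he1]
    refine Prod.ext rfl ?_
    refine ContinuousLinearMap.ext fun v => ?_
    exact (he2 u v).trans (S.apply_symm_apply _)
  constructor
  · rintro ⟨u, hu⟩
    have h4 : X = (S u, Γ (S u)) := hu.symm.trans (h3 u)
    rw [h4]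
  · intro h
    refine ⟨S.symm X.1, (h3 _).trans ?_⟩
    rw [S.apply_symm_apply, h]

/-! ### Smooth sections of the bundle of 2-frames -/

theorem Frame2.coord_mk {c : OpenPartialHomeomorph M (E n)}
    (hc : c ∈ IsManifold.maximalAtlas (𝓡 n) ∞ M) (e : OChart n M) (hx : e.1.symm 0 ∈ c.source) :
    Frame2.coord c (Frame2.mk e) =
      (fderiv ℝ (c ∘ e.1.symm) 0, fderiv ℝ (fderiv ℝ (c ∘ e.1.symm)) 0) := by
  have h : SameJet (Quotient.out (Frame2.mk e)) e := Quotient.mk_out (s := jetSetoid n M) e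
  obtain ⟨h1, h2⟩ := h.2 c hc (h.1 ▸ hx)
  exact Prod.ext h1 h2

/-- A smooth vector field on `LM` has smooth components along a smooth map into `LM`. -/
theorem contMDiffAt_vectorField_coord {s : M → LinB n M} {y₁ : M} {W : Set (LinB n M)}
    (hW : IsOpen W) (hs : ContMDiffAt (𝓡 n) (IL n) ∞ s y₁) (hy : s y₁ ∈ W)
    {X : ∀ p : LinB n M, TangentSpace (IL n) p}
    (hX : ContMDiffOn (IL n) (IL n).tangent ∞
        (fun p => (⟨p, X p⟩ : TangentBundle (IL n) (LinB n M))) W) :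
    ContMDiffAt (𝓡 n) 𝓘(ℝ, E n × (E n →L[ℝ] E n)) ∞ (fun y =>
      (mfderiv (IL n) 𝓘(ℝ, E n × (E n →L[ℝ] E n)) (extChartAt (IL n) (s y₁)) (s y) (X (s y)) :
        E n × (E n →L[ℝ] E n))) y₁ := by
  have h1 : ContMDiffAt (𝓡 n) (IL n).tangent ∞
      (fun y => (⟨s y, X (s y)⟩ : TangentBundle (IL n) (LinB n M))) y₁ :=
    (hX.contMDiffAt (hW.mem_nhds hy)).comp y₁ hs
  have h2 := (contMDiffAt_totalSpace.1 h1).2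
  refine h2.congr_of_eventuallyEq ?_
  have h3 : ∀ᶠ y in 𝓝 y₁, s y ∈ (chartAt (ModelProd (E n) (E n →L[ℝ] E n)) (s y₁)).source :=
    hs.continuousAt.eventually ((chartAt _ (s y₁)).open_source.eventually_mem
      (mem_chart_source _ _))
  filter_upwards [h3] with y hy
  have h4 := TangentBundle.continuousLinearMapAt_trivializationAt (I := IL n) hy
  refine (DFunLike.congr_fun h4 (X (s y))).symm.trans ?_
  exact congrFun (Trivialization.coe_linearMapAt_of_mem _ hy) (X (s y))

/-- If the graph-like subspace `{(A u, Q u)}` lies in `{(V w, B w)}` and `A` is invertible, then `V`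
is invertible and `Q` is recovered as `B V⁻¹ A`. -/
theorem exists_equiv_of_mem_range {F : Type*} [NormedAddCommGroup F] [NormedSpace ℝ F]
    {V A : E n →L[ℝ] E n} {B Q : E n →L[ℝ] F} (hA : A.IsInvertible)
    (h : ∀ u, ∃ w, V w = A u ∧ B w = Q u) :
    V.IsInvertible ∧ Q = (B.comp V.inverse).comp A := by
  obtain ⟨S, rfl⟩ := hA
  have hV : Function.Surjective V := fun v => by
    obtain ⟨w, hw, -⟩ := h (S.symm v)
    exact ⟨w, by simpa using hw⟩
  have hV' : Function.Injective V := (LinearMap.injective_iff_surjective (f := V.toLinearMap)).2 hV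
  let R : E n ≃L[ℝ] E n := (LinearEquiv.ofBijective V.toLinearMap ⟨hV', hV⟩).toContinuousLinearEquiv
  have hR : (R : E n →L[ℝ] E n) = V := rfl
  refine ⟨⟨R, hR⟩, ?_⟩
  ext1 u
  obtain ⟨w, hw, hw'⟩ := h u
  rw [← hR, ContinuousLinearMap.inverse_equiv]
  change Q u = B (R.symm (S u))
  have h1 : R w = S u := hw
  rw [← hw', ← h1, R.symm_apply_apply]

theorem contMDiffAt_sum_smulRight {F : Type*} [NormedAddCommGroup F] [NormedSpace ℝ F]
    {ξ : Fin n → M → F} {y : M} (h : ∀ i, ContMDiffAt (𝓡 n) 𝓘(ℝ, F) ∞ (ξ i) y) :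
    ContMDiffAt (𝓡 n) 𝓘(ℝ, E n →L[ℝ] F) ∞
      (fun y => ∑ i : Fin n, (EuclideanSpace.proj i : E n →L[ℝ] ℝ).smulRight (ξ i y)) y :=
  contMDiffAt_finsetSum fun i _ => ((ContinuousLinearMap.smulRightL ℝ (E n) F
    (EuclideanSpace.proj i)).contDiff.contMDiff.contMDiffAt).comp y (h i)

/-- Smoothness of the first and second derivatives of a composition, as functions of the derivatives
of its factors. -/
theorem contMDiffAt_jet_comp {F : Type*} [NormedAddCommGroup F] [NormedSpace ℝ F]
    {D A : M → F →L[ℝ] F} {D₂ Q : M → F →L[ℝ] F →L[ℝ] F} {y : M}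
    (hD : ContMDiffAt (𝓡 n) 𝓘(ℝ, F →L[ℝ] F) ∞ D y) (hA : ContMDiffAt (𝓡 n) 𝓘(ℝ, F →L[ℝ] F) ∞ A y)
    (hD₂ : ContMDiffAt (𝓡 n) 𝓘(ℝ, F →L[ℝ] F →L[ℝ] F) ∞ D₂ y)
    (hQ : ContMDiffAt (𝓡 n) 𝓘(ℝ, F →L[ℝ] F →L[ℝ] F) ∞ Q y) :
    ContMDiffAt (𝓡 n) 𝓘(ℝ, (F →L[ℝ] F) × (F →L[ℝ] F →L[ℝ] F)) ∞
      (fun y => ((D y).comp (A y),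
        ((ContinuousLinearMap.compL ℝ F F F).flip (A y)).comp ((D₂ y).comp (A y)) +
          (ContinuousLinearMap.compL ℝ F F F (D y)).comp (Q y))) y := by
  have h1 : ContMDiffAt (𝓡 n) 𝓘(ℝ, (F →L[ℝ] F) →L[ℝ] F →L[ℝ] F) ∞
      (fun y => (ContinuousLinearMap.compL ℝ F F F).flip (A y)) y :=
    ((ContinuousLinearMap.compL ℝ F F F).flip.contDiff.contMDiff.contMDiffAt).comp y hA
  have h2 : ContMDiffAt (𝓡 n) 𝓘(ℝ, (F →L[ℝ] F) →L[ℝ] F →L[ℝ] F) ∞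
      (fun y => ContinuousLinearMap.compL ℝ F F F (D y)) y :=
    ((ContinuousLinearMap.compL ℝ F F F).contDiff.contMDiff.contMDiffAt).comp y hD
  exact (hD.clm_comp hA).prodMk_space ((h1.clm_comp (hD₂.clm_comp hA)).add (h2.clm_comp hQ))

/-- A family of 2-frames is smooth in every chart `c` if its coordinates in one chart `c₁` are. -/
theorem contMDiffAt_coord_of_jet {e : M → OChart n M} {y₁ : M} {A : M → E n →L[ℝ] E n}
    {Q : M → E n →L[ℝ] E n →L[ℝ] E n} {c c₁ : OpenPartialHomeomorph M (E n)}
    (hc₁ : c₁ ∈ IsManifold.maximalAtlas (𝓡 n) ∞ M) (hy₁' : y₁ ∈ c₁.source)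
    (hA : ContMDiffAt (𝓡 n) 𝓘(ℝ, E n →L[ℝ] E n) ∞ A y₁)
    (hQ : ContMDiffAt (𝓡 n) 𝓘(ℝ, E n →L[ℝ] E n →L[ℝ] E n) ∞ Q y₁)
    (h : ∀ᶠ y in 𝓝 y₁, (e y).1.symm 0 = y ∧ fderiv ℝ (c₁ ∘ (e y).1.symm) 0 = A y ∧
      fderiv ℝ (fderiv ℝ (c₁ ∘ (e y).1.symm)) 0 = Q y)
    (hc : c ∈ IsManifold.maximalAtlas (𝓡 n) ∞ M) (hy₁ : y₁ ∈ c.source) :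
    ContMDiffAt (𝓡 n) 𝓘(ℝ, (E n →L[ℝ] E n) × (E n →L[ℝ] E n →L[ℝ] E n)) ∞
      (fun y => Frame2.coord c (Frame2.mk (e y))) y₁ := by
  have hφ := contDiffAt_transition hc₁ hc hy₁' hy₁
  have hcs : ContMDiffAt (𝓡 n) 𝓘(ℝ, E n) ∞ c₁ y₁ := contMDiffAt_of_mem_maximalAtlas hc₁ hy₁'
  have hφ1 : ContMDiffAt (𝓡 n) 𝓘(ℝ, E n →L[ℝ] E n) ∞
      (fun y => fderiv ℝ (c ∘ c₁.symm) (c₁ y)) y₁ :=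
    (contDiffAt_fderiv hφ).contMDiffAt.comp y₁ hcs
  have hφ2 : ContMDiffAt (𝓡 n) 𝓘(ℝ, E n →L[ℝ] E n →L[ℝ] E n) ∞
      (fun y => fderiv ℝ (fderiv ℝ (c ∘ c₁.symm)) (c₁ y)) y₁ :=
    (contDiffAt_fderiv (contDiffAt_fderiv hφ)).contMDiffAt.comp y₁ hcs
  refine (contMDiffAt_jet_comp hφ1 hA hφ2 hQ).congr_of_eventuallyEq ?_
  filter_upwards [h, c₁.open_source.mem_nhds hy₁', c.open_source.mem_nhds hy₁] with y h1 h2 h3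
  obtain ⟨h1, h4, h5⟩ := h1
  have h2' : (e y).1.symm 0 ∈ c₁.source := h1.symm ▸ h2
  have h3' : (e y).1.symm 0 ∈ c.source := h1.symm ▸ h3
  rw [Frame2.coord_mk hc (e y) h3']
  refine Prod.ext ?_ ?_
  · refine (fderiv_chart_change hc₁ hc (e y) h2' h3').trans ?_
    rw [h1, h4]
  · refine ContinuousLinearMap.ext fun u => ContinuousLinearMap.ext fun v => ?_
    refine (fderiv_fderiv_chart_change hc₁ hc (e y) h2' h3' u v).trans ?_
    rw [h1, h4, h5]
    rfl

theorem exists_sum_smul_map_of_mem_span {V W : Type*} [AddCommGroup V] [Module ℝ V]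
    [AddCommGroup W] [Module ℝ W] (L : V →ₗ[ℝ] W) {X : Fin n → V} {Z : V}
    (h : Z ∈ Submodule.span ℝ (Set.range X)) : ∃ w : Fin n → ℝ, ∑ i, w i • L (X i) = L Z := by
  obtain ⟨w, rfl⟩ := (Submodule.mem_span_range_iff_exists_fun ℝ).1 h
  exact ⟨w, by simp⟩

/-- If `chartSubspace e` is spanned by vectors `X i`, then the vectors `(dF u, d²F u)` are linear
combinations of their coordinates. -/
theorem frameField_jet_of_mem_span {l₀ l : LinB n M} {e : OChart n M} (hl : frameField e 0 = l)
    (hx : l.proj ∈ (chartAt (E n) l₀.proj).source) {X : Fin n → TangentSpace (IL n) l}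
    (h : ∀ Z : E n × (E n →L[ℝ] E n), Z ∈ chartSubspace e →
      Z ∈ Submodule.span ℝ (Set.range X)) (u : E n) :
    ∃ w : Fin n → ℝ, ∑ i, w i • (mfderiv (IL n) 𝓘(ℝ, E n × (E n →L[ℝ] E n)) (extChartAt (IL n) l₀) l
      (X i) : E n × (E n →L[ℝ] E n)) =
        (fderiv ℝ (chartAt (E n) l₀.proj ∘ e.1.symm) 0 u,
          fderiv ℝ (fderiv ℝ (chartAt (E n) l₀.proj ∘ e.1.symm)) 0 u) := by
  subst hl
  obtain ⟨w, hw⟩ := exists_sum_smul_map_of_mem_span (V := TangentSpace (IL n) (frameField e 0))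
    (W := E n × (E n →L[ℝ] E n))
    (mfderiv (IL n) 𝓘(ℝ, E n × (E n →L[ℝ] E n)) (extChartAt (IL n) l₀)
      (frameField e 0)).toLinearMap (h _ ⟨u, rfl⟩)
  exact ⟨w, hw.trans (mfderiv_frameField (l₀ := l₀) e hx u)⟩

theorem sum_smulRight_apply_of_sum_smul {F₁ F₂ : Type*} [NormedAddCommGroup F₁] [NormedSpace ℝ F₁]
    [NormedAddCommGroup F₂] [NormedSpace ℝ F₂] {ξ : Fin n → F₁ × F₂} {w : Fin n → ℝ} {Z : F₁ × F₂}
    (h : ∑ i, w i • ξ i = Z) :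
    (∑ i : Fin n, (EuclideanSpace.proj i : E n →L[ℝ] ℝ).smulRight (ξ i).1) (WithLp.toLp 2 w) =
      Z.1 ∧
    (∑ i : Fin n, (EuclideanSpace.proj i : E n →L[ℝ] ℝ).smulRight (ξ i).2) (WithLp.toLp 2 w) =
      Z.2 := by
  subst h
  constructor
  · simp [Prod.fst_sum]
  · simp [Prod.snd_sum]

/-- If the pairs `(A y u, Q y u)` are linear combinations of smooth fields `ξ i`, with `A` smooth
and invertible at a point, then `Q` is smooth there. -/
theorem contMDiffAt_of_sum_smul {F : Type*} [NormedAddCommGroup F] [NormedSpace ℝ F]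
    {ξ : Fin n → M → E n × F} {A : M → E n →L[ℝ] E n} {Q : M → E n →L[ℝ] F} {y₁ : M}
    (hξ : ∀ i, ContMDiffAt (𝓡 n) 𝓘(ℝ, E n × F) ∞ (ξ i) y₁)
    (hA : ContMDiffAt (𝓡 n) 𝓘(ℝ, E n →L[ℝ] E n) ∞ A y₁) (hinv : (A y₁).IsInvertible)
    (h : ∀ᶠ y in 𝓝 y₁, ∀ u, ∃ w : Fin n → ℝ, ∑ i, w i • ξ i y = (A y u, Q y u)) :
    ContMDiffAt (𝓡 n) 𝓘(ℝ, E n →L[ℝ] F) ∞ Q y₁ := by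
  have hAi : ∀ᶠ y in 𝓝 y₁, (A y).IsInvertible :=
    hA.continuousAt.eventually ((ContinuousLinearEquiv.isOpen (𝕜 := ℝ)).mem_nhds hinv)
  set V : M → E n →L[ℝ] E n := fun y =>
    ∑ i : Fin n, (EuclideanSpace.proj i : E n →L[ℝ] ℝ).smulRight (ξ i y).1 with hV
  set B : M → E n →L[ℝ] F := fun y =>
    ∑ i : Fin n, (EuclideanSpace.proj i : E n →L[ℝ] ℝ).smulRight (ξ i y).2 with hB
  have hVs : ContMDiffAt (𝓡 n) 𝓘(ℝ, E n →L[ℝ] E n) ∞ V y₁ :=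
    contMDiffAt_sum_smulRight fun i => contDiffAt_fst.contMDiffAt.comp y₁ (hξ i)
  have hBs : ContMDiffAt (𝓡 n) 𝓘(ℝ, E n →L[ℝ] F) ∞ B y₁ :=
    contMDiffAt_sum_smulRight fun i => contDiffAt_snd.contMDiffAt.comp y₁ (hξ i)
  have hkey : ∀ᶠ y in 𝓝 y₁, (V y).IsInvertible ∧ Q y = ((B y).comp (V y).inverse).comp (A y) := by
    filter_upwards [h, hAi] with y hy hyA
    refine exists_equiv_of_mem_range hyA fun u => ?_
    obtain ⟨w, hw⟩ := hy u
    exact ⟨WithLp.toLp 2 w, sum_smulRight_apply_of_sum_smul hw⟩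
  have hVi : ContMDiffAt (𝓡 n) 𝓘(ℝ, E n →L[ℝ] E n) ∞ (fun y => (V y).inverse) y₁ :=
    (hkey.self_of_nhds.1.contDiffAt_map_inverse.contMDiffAt).comp y₁ hVs
  exact ((hBs.clm_comp hVi).clm_comp hA).congr_of_eventuallyEq (hkey.mono fun y hy => hy.2)

/-- 2-frames whose subspaces lie in the span of `n` smooth vector fields along a smooth field of
linear frames form a smooth family. -/
theorem contMDiffAt_coord_mk {s : M → LinB n M} {e : M → OChart n M} {y₁ : M}
    (hs : ContMDiffAt (𝓡 n) (IL n) ∞ s y₁) (hse : ∀ᶠ y in 𝓝 y₁, frameField (e y) 0 = s y)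
    (hsp : ∀ᶠ y in 𝓝 y₁, (s y).proj = y) (hinv : (s y₁).mat.IsInvertible)
    {W : Set (LinB n M)} (hW : IsOpen W) (hyW : s y₁ ∈ W)
    {X : Fin n → ∀ p : LinB n M, TangentSpace (IL n) p}
    (hX : ∀ i, ContMDiffOn (IL n) (IL n).tangent ∞
        (fun p => (⟨p, X i p⟩ : TangentBundle (IL n) (LinB n M))) W)
    (hspan : ∀ᶠ y in 𝓝 y₁, ∀ Z : E n × (E n →L[ℝ] E n), Z ∈ chartSubspace (e y) →
      Z ∈ Submodule.span ℝ (Set.range fun i => X i (s y)))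
    {c : OpenPartialHomeomorph M (E n)} (hc : c ∈ IsManifold.maximalAtlas (𝓡 n) ∞ M)
    (hy₁ : y₁ ∈ c.source) :
    ContMDiffAt (𝓡 n) 𝓘(ℝ, (E n →L[ℝ] E n) × (E n →L[ℝ] E n →L[ℝ] E n)) ∞
      (fun y => Frame2.coord c (Frame2.mk (e y))) y₁ := by
  have hp₁ : (s y₁).proj = y₁ := hsp.self_of_nhds
  set c₁ := chartAt (E n) (s y₁).proj with hc₁
  have hc₁m : c₁ ∈ IsManifold.maximalAtlas (𝓡 n) ∞ M := IsManifold.chart_mem_maximalAtlas _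
  have hy₁' : y₁ ∈ c₁.source := by rw [hc₁, hp₁]; exact mem_chart_source _ _
  have hZ : ContMDiffAt (𝓡 n) 𝓘(ℝ, E n × (E n →L[ℝ] E n)) ∞
      (fun y => extChartAt (IL n) (s y₁) (s y)) y₁ :=
    (contMDiffAt_extChartAt (n := ∞)).comp y₁ hs
  set A : M → E n →L[ℝ] E n := fun y => (extChartAt (IL n) (s y₁) (s y)).2 with hA
  have hAs : ContMDiffAt (𝓡 n) 𝓘(ℝ, E n →L[ℝ] E n) ∞ A y₁ :=
    (contDiffAt_snd.contMDiffAt).comp y₁ hZ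
  have hAi : (A y₁).IsInvertible := by
    rw [hA]
    dsimp only
    rw [extChartAt_self]
    exact hinv
  have hjet : ∀ᶠ y in 𝓝 y₁, (e y).1.symm 0 = y ∧ fderiv ℝ (c₁ ∘ (e y).1.symm) 0 = A y := by
    filter_upwards [hse, hsp, c₁.open_source.mem_nhds hy₁'] with y h1 h2 h5
    have h6 : (e y).1.symm 0 = y := (congrArg TotalSpace.proj h1).trans h2
    have h7 : (e y).1.symm 0 ∈ c₁.source := h6.symm ▸ h5
    have h8 := extChartAt_frameField_zero (l₀ := s y₁) (e y) h7
    rw [h1] at h8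
    exact ⟨h6, (congrArg Prod.snd h8).symm⟩
  refine contMDiffAt_coord_of_jet hc₁m hy₁' hAs (Q := fun y =>
    fderiv ℝ (fderiv ℝ (c₁ ∘ (e y).1.symm)) 0) ?_ (hjet.mono fun y h => ⟨h.1, h.2, rfl⟩) hc hy₁
  refine contMDiffAt_of_sum_smul (fun i => contMDiffAt_vectorField_coord hW hs hyW (hX i))
    hAs hAi ?_
  filter_upwards [hse, hsp, hspan, hjet, c₁.open_source.mem_nhds hy₁'] with y h1 h2 h3 h4 h5 u
  rw [← h4.2]
  exact frameField_jet_of_mem_span h1 (by rw [h2]; exact h5) h3 u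

theorem isSecondOrderStructure_holonomicProlongation {G : Subgroup (GLn n)} {P : Set (LinB n M)}
    (hP : IsGStructure G P) {H : ∀ l : LinB n M, Submodule ℝ (TangentSpace (IL n) l)}
    (hH : IsSymmetricConnection G P H) :
    IsSecondOrderStructure (prolongedGroup G) (holonomicProlongation P) where
  act_mem := by
    rintro _ ⟨e, rfl, he⟩ g hg
    exact ⟨e.act g, rfl, IsAdapted.act hP he hg⟩
  exists_act := by
    rintro _ ⟨e, rfl, he⟩ _ ⟨e', rfl, he'⟩ h
    obtain ⟨g, hg, hj⟩ := IsAdapted.exists_act hP he he' h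
    exact ⟨g, hg, Quotient.sound (s := jetSetoid n M) hj⟩
  exists_section := by
    intro x
    obtain ⟨U, hU, hxU, σ, hσ, hσs⟩ := hP.exists_section x
    have h1 : ∀ y, ∃ e : OChart n M, y ∈ U → frameField e 0 = σ y ∧
        ∀ X : E n × (E n →L[ℝ] E n), X ∈ chartSubspace e ↔ X ∈ H (σ y) := by
      intro y
      by_cases hy : y ∈ U
      · have hyP := (hσ y hy).2
        obtain ⟨e, he⟩ := exists_chart_of_isTorsionFree (hP.subset_LM hyP) (H (σ y))
          (hH.transversal _ hyP) (hH.torsionFree _ hyP)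
        exact ⟨e, fun _ => he⟩
      · exact ⟨centeredChart y, fun h => absurd h hy⟩
    choose e he using h1
    refine ⟨U, hU, hxU, fun y => Frame2.mk (e y), fun y hy => ⟨e y, rfl, ?_, fun X hX => ?_⟩,
      fun y hy => ?_, fun c hc => ?_⟩
    · rw [(he y hy).1]
      exact (hσ y hy).2
    · exact (mem_tangentVectors_congr (he y hy).1 X).2
        (hH.tangent _ (hσ y hy).2 X (((he y hy).2 X).1 hX))
    · exact (congrArg TotalSpace.proj (he y hy).1).trans (hσ y hy).1
    · rintro y ⟨hy, hyc⟩
      have hyU : ∀ᶠ z in 𝓝 y, z ∈ U := hU.mem_nhds hy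
      obtain ⟨W, hW, hyW, X, hX, hspan⟩ := hH.smooth _ (hσ y hy).2
      have hσy : ContMDiffAt (𝓡 n) (IL n) ∞ σ y := hσs.contMDiffAt hyU
      refine (contMDiffAt_coord_mk hσy (hyU.mono fun z hz => (he z hz).1)
        (hyU.mono fun z hz => (hσ z hz).1) (hP.subset_LM (hσ y hy).2) hW hyW hX ?_ hc
        hyc).contMDiffWithinAt
      filter_upwards [hyU, hσy.continuousAt.eventually (hW.mem_nhds hyW)] with z hz hzW Z hZ
      rw [← hspan _ ⟨hzW, (hσ z hz).2⟩]
      exact ((he z hz).2 Z).1 hZ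

end Manifold

end GStr

end

theorem theorem4 {n : ℕ} {M : Type*} [TopologicalSpace M]
    [ChartedSpace (EuclideanSpace ℝ (Fin n)) M] [IsManifold (𝓡 n) ∞ M]
    (G : Subgroup (GStr.GLn n)) (P : Set (GStr.LinB n M)) (hP : GStr.IsGStructure G P)
    (hconn : ∃ H : ∀ l : GStr.LinB n M, Submodule ℝ (TangentSpace (GStr.IL n) l),
      GStr.IsSymmetricConnection G P H) :
    GStr.IsSecondOrderStructure (GStr.prolongedGroup G) (GStr.holonomicProlongation P) := by
  obtain ⟨H, hH⟩ := hconn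
  exact GStr.isSecondOrderStructure_holonomicProlongation hP hH
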